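/- Let $\mathbb T=\mathbb R/\mathbb Z$, and let $\mathbb T^\omega=\prod_{d=1}^\infty\mathbb T$ be the infinite-dimensional torus with the product topology, the metric $\rho(x,y)=\sum_{d=1}^\infty 2^{-d}\,\|x_d-y_d\|$, where $\|\cdot\|$ is the distance to $0$ in $\mathbb T$, and the (completed) product $|\cdot|$ of the normalized Lebesgue measures. A rectangle with sides parallel to the coordinate axes is a set $\prod_{d=1}^\infty I_d$ in which every $I_d$ is an interval (arc) in $\mathbb T$ and $I_d=\mathbb T$ for all but finitely many $d$. Suppose that for every $x\in\mathbb T^\omega$ a family $\mathcal B(x)$ of measurable sets $S\ni x$ with $0<|S|<\infty$ is given. A sequence $(S_n)$ in $\mathcal B(x)$ contracts to $x$, written $(S_n)\Rightarrow x$, if there are radii $r_n>0$ with $r_n\to0$ and $S_n\subseteq\{y:\rho(x,y)<r_n\}$ for all $n$. The family $\mathcal B=\bigcup_x\mathcal B(x)$ is a differentiation basis if for almost every $x$ some sequence contracts to $x$; it is a Busemann–Feller basis if, moreover, $\mathcal B(x)=\{S\in\mathcal B: x\in S\}$ for every $x$ and every $S\in\mathcal B$ is open. For $p\in[1,\infty]$,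 $\mathcal B$ differentiates $L^p(\mathbb T^\omega)$ if for every real-valued $f\in L^p(\mathbb T^\omega)$ and almost every $x$ one has $\lim_{n\to\infty}\frac1{|S_n|}\int_{S_n}f=f(x)$ for every $(S_n)\Rightarrow x$. **Theorem.** For every $p_0\in[1,\infty)$ there exist Busemann–Feller bases $\mathcal B_\ge$ and $\mathcal B_>$ in $\mathbb T^\omega$, all of whose elements are rectangles with sides parallel to the coordinate axes, such that for every $p\in[1,\infty]$: 1. $\mathcal B_\ge$ differentiates $L^p(\mathbb T^\omega)$ if and only if $p\ge p_0$; 2. $\mathcal B_>$ differentiates $L^p(\mathbb T^\omega)$ if and only if $p>p_0$. -/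

import Mathlib

open MeasureTheory Filter Topology

/-- `(S n)` contracts to `x` with respect to the family `B` and the distance function `ρ`. -/
def ContractsTo {X : Type*} (ρ : X → X → ℝ) (B : X → Set (Set X)) (S : ℕ → Set X) (x : X) : Prop :=
  (∀ n, S n ∈ B x) ∧
    ∃ r : ℕ → ℝ, (∀ n, 0 < r n) ∧ Tendsto r atTop (𝓝 0) ∧ ∀ n, S n ⊆ {y | ρ x y < r n}

/-- `B` (given by its families `B x`, `x : X`) is a differentiation basis in `(X, ρ, μ)`. -/
structure IsDifferentiationBasis {X : Type*} [MeasurableSpace X] (ρ : X → X → ℝ) (μ : Measure X)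
    (B : X → Set (Set X)) : Prop where
  measurableSet : ∀ x, ∀ S ∈ B x, MeasurableSet S
  mem : ∀ x, ∀ S ∈ B x, x ∈ S
  measure_pos : ∀ x, ∀ S ∈ B x, 0 < μ S
  measure_lt_top : ∀ x, ∀ S ∈ B x, μ S < ⊤
  exists_contractsTo : ∀ᵐ x ∂μ, ∃ S : ℕ → Set X, ContractsTo ρ B S x

/-- A Busemann–Feller basis: an uncentered differentiation basis all of whose elements are open. -/
structure IsBusemannFellerBasis {X : Type*} [TopologicalSpace X] [MeasurableSpace X]
    (ρ : X → X → ℝ) (μ : Measure X) (B : X → Set (Set X)) : Prop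
    extends IsDifferentiationBasis ρ μ B where
  uncentered : ∀ x, B x = {S | S ∈ ⋃ y, B y ∧ x ∈ S}
  isOpen : ∀ S ∈ ⋃ y, B y, IsOpen S

/-- `B` differentiates `L^p(X, μ)`. -/
def DifferentiatesLp {X : Type*} [MeasurableSpace X] (ρ : X → X → ℝ) (μ : Measure X)
    (B : X → Set (Set X)) (p : ENNReal) : Prop :=
  ∀ f : X → ℝ, MemLp f p μ →
    ∀ᵐ x ∂μ, ∀ S : ℕ → Set X, ContractsTo ρ B S x →
      Tendsto (fun n => ⨍ y in S n, f y ∂μ) atTop (𝓝 (f x))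

/-- The infinite-dimensional torus, with the product topology and the product σ-algebra
(which is its Borel σ-algebra). -/
abbrev TorusOmega : Type := ℕ → UnitAddCircle

/-- The standard metric of the infinite-dimensional torus. The distance of `UnitAddCircle` is
the arc-length distance `min {|s - t|, 1 - |s - t|}` for `s, t ∈ [0, 1]`. Coordinates are
numbered from `0`, so coordinate `d` has weight `2 ^ (-(d + 1))`. -/
noncomputable def torusDist (x y : TorusOmega) : ℝ :=
  ∑' d : ℕ, dist (x d) (y d) / 2 ^ (d + 1)

/-- The normalized Haar measure: the product of the normalized Lebesgue measures. -/
noncomputable def torusMeasure : Measure TorusOmega :=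
  Measure.infinitePi (fun _ : ℕ => (volume : Measure UnitAddCircle))

theorem isProbabilityMeasure_torusMeasure : IsProbabilityMeasure torusMeasure := by
  have : IsProbabilityMeasure (volume : Measure UnitAddCircle) := ⟨UnitAddCircle.measure_univ⟩
  unfold torusMeasure
  infer_instance

/-- An interval (arc) in the circle `ℝ / ℤ`: the image of an interval of the real line. -/
def IsCircleInterval (I : Set UnitAddCircle) : Prop :=
  ∃ J : Set ℝ, J.OrdConnected ∧ I = (fun t : ℝ => (t : UnitAddCircle)) '' J

/-- A rectangle in the infinite-dimensional torus with sides parallel to the coordinate axes: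
a product of intervals, all but finitely many of which are the whole circle. -/
def IsTorusRectangle (R : Set TorusOmega) : Prop :=
  ∃ I : ℕ → Set UnitAddCircle, (∀ d, IsCircleInterval (I d)) ∧
    (∃ d₀ : ℕ, ∀ d, d₀ < d → I d = Set.univ) ∧ R = Set.univ.pi I

/-!
The bases are built in stages. Stage `k` takes `N` fresh coordinates and a depth `M`, puts
`λ = 2 ^ M`, and considers the *core* (all fresh coordinates lie in an arc `I` of length `1 / λ`)
and the `N` *beams* through it (all fresh coordinates but one lie in `I`). Every beam is `λ` times
as large as the core, and two beams of a stage meet in the core only. The rectangles of stage `k`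
are the products of a beam with the cells of a fine dyadic mesh in the coordinates used before. All
open rectangles of all stages form the basis; the union of the beams of a stage is its *reach*.

Failure. The reaches are independent, so if their measures have an infinite sum, almost every point
lies in infinitely many of them. The function `(∑ₖ λₖ ^ p 1_{coreₖ}) ^ (1 / p)` is at least `λₖ` on
the core, hence has average at least one over every rectangle, although it vanishes off the cores.
It belongs to `L ^ p` if `∑ₖ λₖ ^ p |coreₖ|` is finite (`Stages.not_differentiatesLp_basis`).

Differentiation. The average of `f` over a rectangle of stage `k` that contains `x`, where `x` is
not in the core, is a convex combination, with weights `1 / λ` and `1 - 1 / λ`, of the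
average over the core part of the rectangle and the average over the rest. The rest is an atom of a
partition that becomes finer with `k`, so the second average tends to `f x` by Lévy's upward theorem
(`Stages.tendsto_condExp_filtration`). The first term, restricted to the reach, has a `p`-th power
with integral at most `N λ ^ (1 - p) ∫ |f| ^ p` over the core, by Jensen's inequality
(`lintegral_fiber_average_le`). Almost every point lies in finitely many cores, so one may replace
the cores from some stage on by disjoint sets; if `N λ ^ (1 - p)` is bounded, the integrals can be
summed and the first term tends to zero almost everywhere (`Stages.tendsto_core_average`).

It remains to choose the parameters: `λ = 2 ^ (m + 3)` and `N` about `s m * λ ^ (p₀ - 1)`, with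
each `m` repeated until the reaches have total measure about one. The choice `s m = 1` gives
differentiation exactly for `p ≥ p₀`, and `s m = (m + 3) ^ 2` exactly for `p > p₀`.
-/

/-! ### Dyadic arcs of the circle -/

namespace TorusBeam

/-- The index `q` of the half-open dyadic arc `[q / 2 ^ d, (q + 1) / 2 ^ d)` containing `t`. -/
noncomputable def dyadicIndex (d : ℕ) (t : UnitAddCircle) : ℕ :=
  ⌊(2 : ℝ) ^ d * (AddCircle.equivIco (1 : ℝ) 0 t : ℝ)⌋₊

/-- The half-open dyadic arc `[q / 2 ^ d, (q + 1) / 2 ^ d)`. -/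
def dyadicArc (d q : ℕ) : Set UnitAddCircle := {t | dyadicIndex d t = q}

/-- The open dyadic arc `(q / 2 ^ d, (q + 1) / 2 ^ d)`. -/
def openDyadicArc (d q : ℕ) : Set UnitAddCircle :=
  (fun s : ℝ => (s : UnitAddCircle)) '' Set.Ioo ((q : ℝ) / 2 ^ d) (((q : ℝ) + 1) / 2 ^ d)

instance : IsProbabilityMeasure (volume : Measure UnitAddCircle) := ⟨UnitAddCircle.measure_univ⟩

instance : IsProbabilityMeasure torusMeasure := isProbabilityMeasure_torusMeasure

theorem equivIco_nonneg (t : UnitAddCircle) : 0 ≤ (AddCircle.equivIco (1 : ℝ) 0 t : ℝ) :=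
  (AddCircle.equivIco (1 : ℝ) 0 t).2.1

theorem equivIco_lt_one (t : UnitAddCircle) : (AddCircle.equivIco (1 : ℝ) 0 t : ℝ) < 1 := by
  simpa using (AddCircle.equivIco (1 : ℝ) 0 t).2.2

theorem measurable_equivIco :
    Measurable fun t : UnitAddCircle => (AddCircle.equivIco (1 : ℝ) 0 t : ℝ) :=
  measurable_subtype_coe.comp (AddCircle.measurableEquivIco (1 : ℝ) 0).measurable

theorem measurable_dyadicIndex (d : ℕ) : Measurable (dyadicIndex d) :=
  (measurable_equivIco.const_mul _).nat_floor

theorem measurableSet_dyadicArc (d q : ℕ) : MeasurableSet (dyadicArc d q) :=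
  measurable_dyadicIndex d (measurableSet_singleton q)

theorem dyadicIndex_lt (d : ℕ) (t : UnitAddCircle) : dyadicIndex d t < 2 ^ d := by
  rw [dyadicIndex, Nat.floor_lt (mul_nonneg (by positivity) (equivIco_nonneg t))]
  push_cast
  exact mul_lt_of_lt_one_right (by positivity) (equivIco_lt_one t)

theorem dyadicIndex_eq_iff {d q : ℕ} {t : UnitAddCircle} :
    dyadicIndex d t = q ↔ (AddCircle.equivIco (1 : ℝ) 0 t : ℝ) ∈
      Set.Ico ((q : ℝ) / 2 ^ d) (((q : ℝ) + 1) / 2 ^ d) := by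
  have h2 : (0 : ℝ) < 2 ^ d := by positivity
  rw [dyadicIndex, Nat.floor_eq_iff (mul_nonneg h2.le (equivIco_nonneg t)), Set.mem_Ico,
    div_le_iff₀' h2, lt_div_iff₀' h2]

/-- The dyadic arcs of a finer mesh refine those of a coarser mesh. -/
theorem dyadicIndex_congr {a b : ℕ} (hab : a ≤ b) {s t : UnitAddCircle}
    (h : dyadicIndex b s = dyadicIndex b t) : dyadicIndex a s = dyadicIndex a t := by
  have key : ∀ t, dyadicIndex a t = dyadicIndex b t / 2 ^ (b - a) := by
    intro t
    have h3 : (2 : ℝ) ^ b = 2 ^ a * 2 ^ (b - a) := by rw [← pow_add]; congr 1; omega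
    have := Nat.floor_div_natCast ((2 : ℝ) ^ b * (AddCircle.equivIco (1 : ℝ) 0 t : ℝ))
      (2 ^ (b - a))
    rw [dyadicIndex, dyadicIndex, ← this]
    congr 1
    push_cast
    rw [h3]
    field_simp
  rw [key, key, h]

theorem coe_mem_Ico {d q : ℕ} (hq : q < 2 ^ d) {s : ℝ}
    (hs : s ∈ Set.Ico ((q : ℝ) / 2 ^ d) (((q : ℝ) + 1) / 2 ^ d)) :
    (AddCircle.equivIco (1 : ℝ) 0 (s : UnitAddCircle) : ℝ) = s := by
  refine AddCircle.equivIco_coe_of_mem (p := (1 : ℝ)) (a := 0) ⟨le_trans (by positivity) hs.1, ?_⟩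
  refine hs.2.trans_le ?_
  rw [div_le_iff₀ (by positivity), zero_add, one_mul]
  exact_mod_cast hq

theorem openDyadicArc_subset {d q : ℕ} (hq : q < 2 ^ d) : openDyadicArc d q ⊆ dyadicArc d q := by
  rintro _ ⟨s, hs, rfl⟩
  have hs' := Set.Ioo_subset_Ico_self hs
  change dyadicIndex d (s : UnitAddCircle) = q
  rw [dyadicIndex_eq_iff, coe_mem_Ico hq hs']
  exact hs'

theorem isOpen_openDyadicArc (d q : ℕ) : IsOpen (openDyadicArc d q) :=
  QuotientAddGroup.isOpenMap_coe _ isOpen_Ioo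

theorem isCircleInterval_openDyadicArc (d q : ℕ) : IsCircleInterval (openDyadicArc d q) :=
  ⟨_, Set.ordConnected_Ioo, rfl⟩

theorem isCircleInterval_univ : IsCircleInterval Set.univ :=
  ⟨Set.univ, Set.ordConnected_univ, by
    rw [Set.image_univ]; exact (QuotientAddGroup.mk_surjective).range_eq.symm⟩

theorem volume_dyadicArc {d q : ℕ} (hq : q < 2 ^ d) :
    volume (dyadicArc d q) = ((2 : ENNReal) ^ d)⁻¹ := by
  have hpre : volume (dyadicArc d q) =
      volume (Set.Ico ((q : ℝ) / 2 ^ d) (((q : ℝ) + 1) / 2 ^ d)) := by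
    rw [AddCircle.add_projection_respects_measure (1 : ℝ) 0 (measurableSet_dyadicArc d q)]
    refine measure_congr ?_
    -- the two sets differ at most at the endpoints of the fundamental domain
    have h0 : ∀ᵐ s : ℝ, s ≠ 0 ∧ s ≠ 1 := by
      filter_upwards [(Set.countable_singleton (0 : ℝ)).ae_notMem volume,
        (Set.countable_singleton (1 : ℝ)).ae_notMem volume] with s h1 h2
      exact ⟨h1, h2⟩
    filter_upwards [h0] with s hs
    refine propext ?_
    change (dyadicIndex d (s : UnitAddCircle) = q ∧ s ∈ Set.Ioc 0 (0 + 1)) ↔ s ∈ Set.Ico _ _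
    constructor
    · rintro ⟨h1, h2⟩
      rw [dyadicIndex_eq_iff, AddCircle.equivIco_coe_of_mem (p := (1 : ℝ)) (a := 0)
        ⟨h2.1.le, lt_of_le_of_ne h2.2 (by simpa using hs.2)⟩] at h1
      exact h1
    · intro h
      have h1 := coe_mem_Ico hq h
      refine ⟨by rw [dyadicIndex_eq_iff, h1]; exact h, ?_⟩
      have h2 := equivIco_nonneg (s : UnitAddCircle)
      have h3 := equivIco_lt_one (s : UnitAddCircle)
      rw [h1] at h2 h3
      exact ⟨lt_of_le_of_ne h2 (Ne.symm hs.1), by linarith⟩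
  rw [hpre, Real.volume_Ico]
  have : ((q : ℝ) + 1) / 2 ^ d - q / 2 ^ d = (2 ^ d)⁻¹ := by ring
  rw [this, ENNReal.ofReal_inv_of_pos (by positivity), ENNReal.ofReal_pow (by norm_num)]
  norm_num

instance : NullSingletonClass (volume : Measure UnitAddCircle) where
  measure_singleton t := by
    rw [← Metric.closedBall_zero, AddCircle.volume_closedBall]
    simp

theorem ae_mem_openDyadicArc :
    ∀ᵐ t : UnitAddCircle, ∀ d q : ℕ, t ∈ dyadicArc d q → t ∈ openDyadicArc d q := by
  have hc : (Set.range fun a : ℕ × ℕ => (((a.1 : ℝ) / 2 ^ a.2 : ℝ) : UnitAddCircle)).Countable :=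
    Set.countable_range _
  filter_upwards [hc.ae_notMem volume] with t ht d q h
  have h1 := dyadicIndex_eq_iff.1 h
  refine ⟨(AddCircle.equivIco (1 : ℝ) 0 t : ℝ), ⟨lt_of_le_of_ne h1.1 ?_, h1.2⟩,
    AddCircle.coe_equivIco⟩
  intro h2
  exact ht ⟨(q, d), by simp only [h2]; exact AddCircle.coe_equivIco⟩

theorem dist_le_of_dyadicIndex_eq {d : ℕ} {s t : UnitAddCircle}
    (h : dyadicIndex d s = dyadicIndex d t) : dist s t ≤ (2 ^ d)⁻¹ := by
  have hs := dyadicIndex_eq_iff.1 h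
  have ht := dyadicIndex_eq_iff.1 (rfl : dyadicIndex d t = dyadicIndex d t)
  have e : ((dyadicIndex d t : ℝ) + 1) / 2 ^ d = dyadicIndex d t / 2 ^ d + (2 ^ d)⁻¹ := by ring
  rw [e] at hs ht
  rw [dist_eq_norm]
  have : s - t = (((AddCircle.equivIco (1 : ℝ) 0 s : ℝ) - (AddCircle.equivIco (1 : ℝ) 0 t : ℝ) : ℝ)
      : UnitAddCircle) := by
    rw [AddCircle.coe_sub, AddCircle.coe_equivIco, AddCircle.coe_equivIco]
  rw [this]
  rw [UnitAddCircle.norm_eq]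
  refine (round_le _ 0).trans ?_
  rw [Int.cast_zero, sub_zero, abs_le]
  constructor <;> linarith [hs.1, hs.2, ht.1, ht.2]

theorem dist_add_half (t : UnitAddCircle) :
    dist t (t + ((2⁻¹ : ℝ) : UnitAddCircle)) = 2⁻¹ := by
  rw [dist_eq_norm, sub_add_cancel_left, norm_neg]
  have := AddCircle.norm_half_period_eq (p := (1 : ℝ))
  simpa using this

theorem dist_le_one (s t : UnitAddCircle) : dist s t ≤ 1 := by
  rw [dist_eq_norm]
  refine (AddCircle.norm_le_half_period (1 : ℝ) one_ne_zero).trans ?_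
  norm_num

end TorusBeam

/-! ### Stages, cells, cores and beams -/

namespace TorusBeam

/-- The parameters of the construction. Stage `k` uses `width k` fresh coordinates and the arc
of length `2 ^ (-depth k)` in each of them. -/
structure Stages where
  /-- the number of fresh coordinates of stage `k` -/
  width : ℕ → ℕ
  /-- the depth of the dyadic arcs used in the fresh coordinates of stage `k` -/
  depth : ℕ → ℕ
  width_pos : ∀ k, 0 < width k
  depth_pos : ∀ k, 0 < depth k

namespace Stages

variable (D : Stages)

/-- The first coordinate that is not used before stage `k`. -/
def start (k : ℕ) : ℕ := ∑ i ∈ Finset.range k, D.width i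

/-- The depth of the dyadic mesh that stage `k` uses in the coordinates before `start k`. It is
at least `k`, and large enough to resolve the arcs of all earlier stages. -/
def mesh (k : ℕ) : ℕ := k + ∑ i ∈ Finset.range k, D.depth i

/-- The fresh coordinates of stage `k`. -/
def fresh (k : ℕ) : Finset ℕ := Finset.Ico (D.start k) (D.start (k + 1))

theorem start_succ (k : ℕ) : D.start (k + 1) = D.start k + D.width k :=
  Finset.sum_range_succ _ _

theorem start_strictMono : StrictMono D.start :=
  strictMono_nat_of_lt_succ fun k => by
    rw [D.start_succ]; exact Nat.lt_add_of_pos_right (D.width_pos k)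

theorem mesh_mono : Monotone D.mesh :=
  monotone_nat_of_le_succ fun k => by
    rw [mesh, mesh, Finset.sum_range_succ]; omega

theorem le_start (k : ℕ) : k ≤ D.start k := D.start_strictMono.le_apply

theorem le_mesh (k : ℕ) : k ≤ D.mesh k := Nat.le_add_right _ _

theorem depth_le_mesh {i k : ℕ} (h : i < k) : D.depth i ≤ D.mesh k :=
  (Finset.single_le_sum (f := D.depth) (fun _ _ => Nat.zero_le _) (Finset.mem_range.2 h)).trans
    (Nat.le_add_left _ _)

theorem card_fresh (k : ℕ) : (D.fresh k).card = D.width k := by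
  rw [fresh, Nat.card_Ico, start_succ, Nat.add_sub_cancel_left]

theorem mem_fresh {k i : ℕ} : i ∈ D.fresh k ↔ D.start k ≤ i ∧ i < D.start (k + 1) :=
  Finset.mem_Ico

/-- The code of `x` at stage `k` tells which mesh arcs contain the old coordinates of `x`. Its
fibers are the cells of stage `k`. -/
noncomputable def code (k : ℕ) (x : TorusOmega) : Fin (D.start k) → ℕ :=
  fun i => dyadicIndex (D.mesh k) (x i)

/-- The core of stage `k`: all fresh coordinates lie in the distinguished arc. -/
def core (k : ℕ) : Set TorusOmega :=
  Set.pi (D.fresh k : Set ℕ) fun _ => dyadicArc (D.depth k) 0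

/-- The beam of stage `k` in direction `j`: all fresh coordinates other than the `j`-th lie in
the distinguished arc. -/
def beam (k j : ℕ) : Set TorusOmega :=
  Set.pi ((D.fresh k).erase j : Finset ℕ) fun _ => dyadicArc (D.depth k) 0

/-- The union of the beams of stage `k`. -/
def reach (k : ℕ) : Set TorusOmega := ⋃ j ∈ D.fresh k, D.beam k j

/-- The depth of the arcs of the rectangles of stage `k` in coordinate `i`. -/
def level (k i : ℕ) : ℕ := if i < D.start k then D.mesh k else D.depth k

/-- The indices of the arcs of the rectangles of stage `k` over the cell with code `c`. -/
def label (k : ℕ) (c : Fin (D.start k) → ℕ) (i : ℕ) : ℕ :=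
  if h : i < D.start k then c ⟨i, h⟩ else 0

/-- The open rectangle over the cell with code `c` and the beam in direction `j`. -/
def rect (k j : ℕ) (c : Fin (D.start k) → ℕ) : Set TorusOmega :=
  Set.pi ((Finset.range (D.start (k + 1))).erase j : Finset ℕ)
    fun i => openDyadicArc (D.level k i) (D.label k c i)

variable {D}

theorem mem_core {k : ℕ} {x : TorusOmega} :
    x ∈ D.core k ↔ ∀ i ∈ D.fresh k, dyadicIndex (D.depth k) (x i) = 0 := Iff.rfl

theorem mem_beam {k j : ℕ} {x : TorusOmega} :
    x ∈ D.beam k j ↔ ∀ i ∈ D.fresh k, i ≠ j → dyadicIndex (D.depth k) (x i) = 0 := by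
  simp only [beam, Set.mem_pi, Finset.mem_coe, Finset.mem_erase, and_imp]
  exact ⟨fun h i hi hj => h i hj hi, fun h i hj hi => h i hi hj⟩

theorem core_subset_beam (k j : ℕ) : D.core k ⊆ D.beam k j :=
  fun _ hx => mem_beam.2 fun i hi _ => mem_core.1 hx i hi

theorem mem_reach {k : ℕ} {x : TorusOmega} : x ∈ D.reach k ↔ ∃ j ∈ D.fresh k, x ∈ D.beam k j := by
  simp [reach]

theorem label_lt {k : ℕ} {c : Fin (D.start k) → ℕ} (hc : ∀ i, c i < 2 ^ D.mesh k) (i : ℕ) :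
    D.label k c i < 2 ^ D.level k i := by
  rw [label, level]
  split_ifs with h
  · exact hc _
  · positivity

theorem code_lt (k : ℕ) (x : TorusOmega) (i : Fin (D.start k)) : D.code k x i < 2 ^ D.mesh k :=
  dyadicIndex_lt _ _

theorem code_eq_iff {k : ℕ} {c : Fin (D.start k) → ℕ} {x : TorusOmega} :
    D.code k x = c ↔ ∀ i < D.start k, x i ∈ dyadicArc (D.level k i) (D.label k c i) := by
  simp only [funext_iff, Fin.forall_iff, code]
  refine forall₂_congr fun i hi => ?_
  rw [level, label, if_pos hi, dif_pos hi]
  rfl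

theorem cell_inter_core (k : ℕ) (c : Fin (D.start k) → ℕ) :
    D.code k ⁻¹' {c} ∩ D.core k = Set.pi (Finset.range (D.start (k + 1)) : Finset ℕ)
      fun i => dyadicArc (D.level k i) (D.label k c i) := by
  ext x
  have hs := D.start_strictMono k.lt_succ_self
  simp only [Set.mem_inter_iff, Set.mem_preimage, Set.mem_singleton_iff, code_eq_iff, mem_core,
    Set.mem_pi, Finset.mem_coe, Finset.mem_range, mem_fresh]
  constructor
  · rintro ⟨h1, h2⟩ i hi
    by_cases h : i < D.start k
    · exact h1 i h
    · rw [level, label, if_neg h, dif_neg h]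
      exact h2 i ⟨not_lt.1 h, hi⟩
  · refine fun h => ⟨fun i hi => h i (hi.trans hs), fun i hi => ?_⟩
    have := h i hi.2
    rwa [level, label, if_neg (not_lt.2 hi.1), dif_neg (not_lt.2 hi.1)] at this

theorem cell_inter_beam {k j : ℕ} (hj : j ∈ D.fresh k) (c : Fin (D.start k) → ℕ) :
    D.code k ⁻¹' {c} ∩ D.beam k j = Set.pi ((Finset.range (D.start (k + 1))).erase j : Finset ℕ)
      fun i => dyadicArc (D.level k i) (D.label k c i) := by
  ext x
  have hs := D.start_strictMono k.lt_succ_self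
  rw [mem_fresh] at hj
  simp only [Set.mem_inter_iff, Set.mem_preimage, Set.mem_singleton_iff, code_eq_iff, mem_beam,
    Set.mem_pi, Finset.mem_coe, Finset.mem_erase, Finset.mem_range, mem_fresh]
  constructor
  · rintro ⟨h1, h2⟩ i ⟨hij, hi⟩
    by_cases h : i < D.start k
    · exact h1 i h
    · rw [level, label, if_neg h, dif_neg h]
      exact h2 i ⟨not_lt.1 h, hi⟩ hij
  · refine fun h => ⟨fun i hi => h i ⟨by omega, hi.trans hs⟩, fun i hi hij => ?_⟩
    have := h i ⟨hij, hi.2⟩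
    rwa [level, label, if_neg (not_lt.2 hi.1), dif_neg (not_lt.2 hi.1)] at this

theorem torusMeasure_pi (s : Finset ℕ) (a q : ℕ → ℕ) :
    torusMeasure (Set.pi (s : Set ℕ) fun i => dyadicArc (a i) (q i)) =
      ∏ i ∈ s, volume (dyadicArc (a i) (q i)) :=
  Measure.infinitePi_pi _ fun _ _ => measurableSet_dyadicArc _ _

theorem measurable_code (k : ℕ) : Measurable (D.code k) :=
  measurable_pi_lambda _ fun _ => (measurable_dyadicIndex _).comp (measurable_pi_apply _)

theorem measurableSet_cell (k : ℕ) (c : Fin (D.start k) → ℕ) :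
    MeasurableSet (D.code k ⁻¹' {c}) :=
  measurable_code k (measurableSet_singleton c)

theorem measurableSet_core (k : ℕ) : MeasurableSet (D.core k) :=
  MeasurableSet.pi (Finset.countable_toSet _) fun _ _ => measurableSet_dyadicArc _ _

theorem measurableSet_beam (k j : ℕ) : MeasurableSet (D.beam k j) :=
  MeasurableSet.pi (Finset.countable_toSet _) fun _ _ => measurableSet_dyadicArc _ _

theorem measurableSet_reach (k : ℕ) : MeasurableSet (D.reach k) :=
  Finset.measurableSet_biUnion _ fun _ _ => measurableSet_beam _ _

/-- A beam is `2 ^ depth k` times as large as the core, in every cell. -/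
theorem measure_cell_inter_beam {k j : ℕ} (hj : j ∈ D.fresh k) (c : Fin (D.start k) → ℕ) :
    torusMeasure (D.code k ⁻¹' {c} ∩ D.beam k j) =
      2 ^ D.depth k * torusMeasure (D.code k ⁻¹' {c} ∩ D.core k) := by
  rw [cell_inter_beam hj, cell_inter_core, torusMeasure_pi, torusMeasure_pi]
  rw [mem_fresh] at hj
  rw [← Finset.mul_prod_erase _ _ (Finset.mem_range.2 hj.2), ← mul_assoc, level, label,
    if_neg (not_lt.2 hj.1), dif_neg (not_lt.2 hj.1), volume_dyadicArc (by positivity),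
    ENNReal.mul_inv_cancel (by positivity) (by finiteness), one_mul]

theorem measure_cell_inter_core_pos {k : ℕ} {c : Fin (D.start k) → ℕ}
    (hc : ∀ i, c i < 2 ^ D.mesh k) : 0 < torusMeasure (D.code k ⁻¹' {c} ∩ D.core k) := by
  rw [cell_inter_core, torusMeasure_pi, pos_iff_ne_zero, Finset.prod_ne_zero_iff]
  intro i _
  rw [volume_dyadicArc (label_lt hc i)]
  exact ENNReal.inv_ne_zero.2 (by finiteness)

theorem measure_cell_inter_reach_le (k : ℕ) (c : Fin (D.start k) → ℕ) :
    torusMeasure (D.code k ⁻¹' {c} ∩ D.reach k) ≤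
      (D.width k * 2 ^ D.depth k) * torusMeasure (D.code k ⁻¹' {c} ∩ D.core k) := by
  rw [reach, Set.inter_iUnion₂]
  refine (measure_biUnion_finset_le _ _).trans ?_
  rw [Finset.sum_congr rfl fun j hj => measure_cell_inter_beam hj c, Finset.sum_const,
    card_fresh, nsmul_eq_mul, mul_assoc]

theorem measure_core (k : ℕ) :
    torusMeasure (D.core k) = ((2 : ENNReal) ^ D.depth k)⁻¹ ^ D.width k := by
  rw [core, torusMeasure_pi _ (fun _ => D.depth k) (fun _ => 0)]
  simp [volume_dyadicArc, card_fresh]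

theorem measure_beam {k j : ℕ} (hj : j ∈ D.fresh k) :
    torusMeasure (D.beam k j) = ((2 : ENNReal) ^ D.depth k)⁻¹ ^ (D.width k - 1) := by
  rw [beam, torusMeasure_pi _ (fun _ => D.depth k) (fun _ => 0)]
  simp [volume_dyadicArc, card_fresh, Finset.card_erase_of_mem hj]

theorem rect_subset {k j : ℕ} (hj : j ∈ D.fresh k) {c : Fin (D.start k) → ℕ}
    (hc : ∀ i, c i < 2 ^ D.mesh k) : D.rect k j c ⊆ D.code k ⁻¹' {c} ∩ D.beam k j := by
  rw [cell_inter_beam hj]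
  exact Set.pi_mono fun i _ => openDyadicArc_subset (label_lt hc i)

theorem ae_mem_rect : ∀ᵐ x ∂torusMeasure, ∀ k, ∀ j ∈ D.fresh k, ∀ c : Fin (D.start k) → ℕ,
    x ∈ D.code k ⁻¹' {c} ∩ D.beam k j → x ∈ D.rect k j c := by
  have h : ∀ᵐ x ∂torusMeasure, ∀ i : ℕ, ∀ d q : ℕ,
      x i ∈ dyadicArc d q → x i ∈ openDyadicArc d q :=
    ae_all_iff.2 fun i => (measurePreserving_eval_infinitePi
      (fun _ : ℕ => (volume : Measure UnitAddCircle)) i).quasiMeasurePreserving.ae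
        ae_mem_openDyadicArc
  filter_upwards [h] with x hx k j hj c hxc
  rw [cell_inter_beam hj] at hxc
  exact fun i hi => hx i _ _ (hxc i hi)

theorem rect_ae_eq {k j : ℕ} (hj : j ∈ D.fresh k) {c : Fin (D.start k) → ℕ}
    (hc : ∀ i, c i < 2 ^ D.mesh k) :
    D.rect k j c =ᵐ[torusMeasure] (D.code k ⁻¹' {c} ∩ D.beam k j : Set TorusOmega) := by
  filter_upwards [ae_mem_rect (D := D)] with x hx
  exact propext ⟨fun h => rect_subset hj hc h, hx k j hj c⟩

theorem isOpen_rect (k j : ℕ) (c : Fin (D.start k) → ℕ) : IsOpen (D.rect k j c) :=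
  isOpen_set_pi (Finset.finite_toSet _) fun _ _ => isOpen_openDyadicArc _ _

theorem isTorusRectangle_rect (k j : ℕ) (c : Fin (D.start k) → ℕ) :
    IsTorusRectangle (D.rect k j c) := by
  classical
  refine ⟨fun i => if i ∈ (Finset.range (D.start (k + 1))).erase j then
    openDyadicArc (D.level k i) (D.label k c i) else Set.univ, fun i => ?_,
    ⟨D.start (k + 1), fun d hd => if_neg ?_⟩, ?_⟩
  · dsimp only
    split_ifs
    exacts [isCircleInterval_openDyadicArc _ _, isCircleInterval_univ]
  · simp [hd.le]
  · rw [rect]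
    exact (Set.univ_pi_ite (((Finset.range (D.start (k + 1))).erase j : Finset ℕ) : Set ℕ)
      fun i => openDyadicArc (D.level k i) (D.label k c i)).symm

/-- Whether `x` belongs to the core of an earlier stage is determined by its cell. -/
theorem mem_core_congr {i k : ℕ} (hik : i < k) {x y : TorusOmega} (h : D.code k x = D.code k y) :
    x ∈ D.core i ↔ y ∈ D.core i := by
  simp only [mem_core]
  refine forall₂_congr fun l hl => ?_
  have hl' : l < D.start k :=
    (mem_fresh _ |>.1 hl).2.trans_le (D.start_strictMono.monotone (Nat.succ_le_of_lt hik))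
  rw [dyadicIndex_congr (D.depth_le_mesh hik) (congrFun h ⟨l, hl'⟩)]

/-- The differentiation basis: at `x`, all rectangles of all stages that contain `x`. -/
def basis (D : Stages) (x : TorusOmega) : Set (Set TorusOmega) :=
  {R | (∃ k, ∃ j ∈ D.fresh k, ∃ c : Fin (D.start k) → ℕ, (∀ i, c i < 2 ^ D.mesh k) ∧
    R = D.rect k j c) ∧ x ∈ R}

theorem measure_rect {k j : ℕ} (hj : j ∈ D.fresh k) {c : Fin (D.start k) → ℕ}
    (hc : ∀ i, c i < 2 ^ D.mesh k) : torusMeasure (D.rect k j c) =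
      2 ^ D.depth k * torusMeasure (D.code k ⁻¹' {c} ∩ D.core k) := by
  rw [measure_congr (rect_ae_eq hj hc), measure_cell_inter_beam hj]

theorem summable_torusDist (x y : TorusOmega) :
    Summable fun d : ℕ => dist (x d) (y d) / 2 ^ (d + 1) := by
  refine Summable.of_nonneg_of_le (fun d => by positivity) (fun d => ?_) summable_geometric_two
  rw [one_div, inv_pow, div_eq_mul_inv]
  calc dist (x d) (y d) * (2 ^ (d + 1))⁻¹ ≤ 1 * (2 ^ d)⁻¹ := by
        gcongr
        · exact dist_le_one _ _
        · norm_num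
        · omega
    _ = _ := one_mul _

theorem dist_div_le_torusDist (x y : TorusOmega) (d : ℕ) :
    dist (x d) (y d) / 2 ^ (d + 1) ≤ torusDist x y :=
  (summable_torusDist x y).le_tsum d fun _ _ => by positivity

/-- An upper bound for the distance of two points of the same cell of stage `k`. -/
noncomputable def cellRadius (D : Stages) (k : ℕ) : ℝ :=
  ∑' d : ℕ, (if d < D.start k then (2 ^ D.mesh k)⁻¹ else 1) / 2 ^ (d + 1)

theorem torusDist_le_cellRadius {k : ℕ} {x y : TorusOmega} (h : D.code k x = D.code k y) :
    torusDist x y ≤ D.cellRadius k := by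
  refine (summable_torusDist x y).tsum_le_tsum (fun d => ?_) ?_
  · gcongr
    split_ifs with hd
    · exact dist_le_of_dyadicIndex_eq (congrFun h ⟨d, hd⟩)
    · exact dist_le_one _ _
  · refine Summable.of_nonneg_of_le (fun d => ?_) (fun d => ?_) summable_geometric_two
    · split_ifs <;> positivity
    · rw [one_div, inv_pow, div_eq_mul_inv]
      calc _ ≤ 1 * ((2 : ℝ) ^ d)⁻¹ := by
            gcongr
            · split_ifs
              · exact inv_le_one_of_one_le₀ (one_le_pow₀ (by norm_num))
              · exact le_rfl
            · norm_num
            · omega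
        _ = _ := one_mul _

theorem tendsto_cellRadius : Tendsto D.cellRadius atTop (𝓝 0) := by
  have : (0 : ℝ) = ∑' _ : ℕ, 0 := tsum_zero.symm
  rw [this]
  refine tendsto_tsum_of_dominated_convergence (bound := fun d => ((1 : ℝ) / 2) ^ d)
    summable_geometric_two (fun d => ?_) (Eventually.of_forall fun k d => ?_)
  · have h0 : Tendsto (fun k => ((2 : ℝ) ^ D.mesh k)⁻¹ / 2 ^ (d + 1)) atTop (𝓝 (0 / 2 ^ (d + 1))) :=
      ((tendsto_pow_atTop_atTop_of_one_lt one_lt_two).comp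
        (tendsto_atTop_mono D.le_mesh tendsto_id)).inv_tendsto_atTop.div_const _
    rw [zero_div] at h0
    refine h0.congr' ?_
    filter_upwards [eventually_gt_atTop d] with k hk
    rw [if_pos (hk.trans_le (D.le_start k))]
  · have h1 : (0 : ℝ) ≤ (if d < D.start k then (2 ^ D.mesh k)⁻¹ else 1) := by
      split_ifs <;> positivity
    rw [Real.norm_of_nonneg (by positivity), one_div, inv_pow, div_eq_mul_inv]
    calc _ ≤ 1 * ((2 : ℝ) ^ d)⁻¹ := by
          gcongr
          · split_ifs
            · exact inv_le_one_of_one_le₀ (one_le_pow₀ (by norm_num))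
            · exact le_rfl
          · norm_num
          · omega
      _ = _ := one_mul _

/-- Every rectangle of stage `k` is unrestricted in the coordinate `start (k + 1)`, so a ball that
contains it cannot be too small. -/
theorem half_pow_le_of_rect_subset {k j : ℕ} {c : Fin (D.start k) → ℕ} {x : TorusOmega} {r : ℝ}
    (hx : x ∈ D.rect k j c) (h : D.rect k j c ⊆ {y | torusDist x y < r}) :
    2⁻¹ / 2 ^ (D.start (k + 1) + 1) < r := by
  classical
  set d := D.start (k + 1) with hd
  have hy : Function.update x d (x d + ((2⁻¹ : ℝ) : UnitAddCircle)) ∈ D.rect k j c := by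
    intro i hi
    have : i ≠ d := by
      simp only [Finset.coe_erase, Set.mem_sdiff, Finset.mem_coe, Finset.mem_range] at hi
      omega
    rw [Function.update_of_ne this]
    exact hx i hi
  refine lt_of_le_of_lt ?_ (h hy)
  have := dist_div_le_torusDist x (Function.update x d (x d + ((2⁻¹ : ℝ) : UnitAddCircle))) d
  rwa [Function.update_self, dist_add_half] at this

/-- The stages of a contracting sequence of rectangles tend to infinity. -/
theorem tendsto_stage {S : ℕ → Set TorusOmega} {x : TorusOmega}
    (hS : ContractsTo torusDist D.basis S x) {k : ℕ → ℕ}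
    (hk : ∀ n, ∃ j, ∃ c : Fin (D.start (k n)) → ℕ, S n = D.rect (k n) j c) :
    Tendsto k atTop atTop := by
  obtain ⟨hmem, r, -, hr, hsub⟩ := hS
  refine tendsto_atTop.2 fun K => ?_
  have hpos : (0 : ℝ) < 2⁻¹ / 2 ^ (D.start (K + 1) + 1) := by positivity
  filter_upwards [hr.eventually_lt_const hpos] with n hn
  by_contra! hlt
  obtain ⟨j, c, hSn⟩ := hk n
  have h1 := half_pow_le_of_rect_subset (hSn ▸ (hmem n).2) (hSn ▸ hsub n)
  have h2 : (2⁻¹ : ℝ) / 2 ^ (D.start (K + 1) + 1) ≤ 2⁻¹ / 2 ^ (D.start (k n + 1) + 1) := by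
    gcongr
    · norm_num
    · exact D.start_strictMono.monotone (by omega)
  linarith

theorem basis_isBusemannFeller
    (hreach : ∀ᵐ x ∂torusMeasure, ∃ᶠ k in atTop, x ∈ D.reach k) :
    IsBusemannFellerBasis torusDist torusMeasure D.basis where
  measurableSet := by
    rintro x _ ⟨⟨k, j, -, c, -, rfl⟩, -⟩
    refine MeasurableSet.pi (Finset.countable_toSet _) fun _ _ =>
      (isOpen_openDyadicArc _ _).measurableSet
  mem := fun _ _ hS => hS.2
  measure_pos := by
    rintro x _ ⟨⟨k, j, hj, c, hc, rfl⟩, -⟩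
    rw [measure_rect hj hc]
    exact ENNReal.mul_pos (by positivity) (measure_cell_inter_core_pos hc).ne'
  measure_lt_top := fun _ _ _ => measure_lt_top _ _
  exists_contractsTo := by
    filter_upwards [hreach, ae_mem_rect (D := D)] with x hx hrect
    obtain ⟨φ, hφ, hφx⟩ := extraction_of_frequently_atTop hx
    choose j hj hxj using fun n => mem_reach.1 (hφx n)
    have hmem : ∀ n, x ∈ D.rect (φ n) (j n) (D.code (φ n) x) := fun n =>
      hrect _ _ (hj n) _ ⟨rfl, hxj n⟩
    refine ⟨fun n => D.rect (φ n) (j n) (D.code (φ n) x),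
      fun n => ⟨⟨φ n, j n, hj n, _, code_lt _ _, rfl⟩, hmem n⟩,
      fun n => D.cellRadius (φ n) + 1 / ((n : ℝ) + 1), fun n => ?_, ?_, fun n y hy => ?_⟩
    · have : 0 ≤ D.cellRadius (φ n) := by
        refine tsum_nonneg fun d => ?_
        split_ifs <;> positivity
      positivity
    · simpa using (tendsto_cellRadius.comp hφ.tendsto_atTop).add
        tendsto_one_div_add_atTop_nhds_zero_nat
    · have := (rect_subset (hj n) (code_lt _ _) hy).1
      refine (torusDist_le_cellRadius (Eq.symm this)).trans_lt ?_
      exact lt_add_of_pos_right _ (by positivity)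
  uncentered := by
    intro x
    ext R
    simp only [basis, Set.mem_iUnion, Set.mem_ofPred_eq]
    exact ⟨fun h => ⟨⟨x, h⟩, h.2⟩, fun h => ⟨h.1.choose_spec.1, h.2⟩⟩
  isOpen := by
    intro S hS
    obtain ⟨x, ⟨k, j, -, c, -, rfl⟩, -⟩ := Set.mem_iUnion.1 hS
    exact isOpen_rect _ _ _

theorem isTorusRectangle_of_mem_basis {R : Set TorusOmega} (hR : R ∈ ⋃ x, D.basis x) :
    IsTorusRectangle R := by
  obtain ⟨x, ⟨k, j, -, c, -, rfl⟩, -⟩ := Set.mem_iUnion.1 hR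
  exact isTorusRectangle_rect _ _ _

end Stages
end TorusBeam

/-! ### Conditional expectations on countable partitions -/

namespace TorusBeam

section General

variable {Ω ι : Type*} [MeasurableSpace Ω] [MeasurableSpace ι] {μ : Measure Ω}

/-- On a fiber of positive measure, the conditional expectation with respect to the σ-algebra
generated by a map is the average over the fiber. -/
theorem condExp_comap_eq_setAverage [IsFiniteMeasure μ] [MeasurableSingletonClass ι] {φ : Ω → ι}
    (hφ : Measurable φ) {f : Ω → ℝ} (hf : Integrable f μ) {x : Ω}
    (hx : μ (φ ⁻¹' {φ x}) ≠ 0) :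
    (μ[f | MeasurableSpace.comap φ inferInstance]) x = ⨍ y in φ ⁻¹' {φ x}, f y ∂μ := by
  have hle : MeasurableSpace.comap φ inferInstance ≤ (inferInstance : MeasurableSpace Ω) :=
    hφ.comap_le
  have hA : MeasurableSet[MeasurableSpace.comap φ inferInstance] (φ ⁻¹' {φ x}) :=
    ⟨_, measurableSet_singleton _, rfl⟩
  have h1 := setIntegral_condExp hle hf hA
  have h2 : ∀ y ∈ φ ⁻¹' {φ x}, (μ[f | MeasurableSpace.comap φ inferInstance]) y =
      (μ[f | MeasurableSpace.comap φ inferInstance]) x := fun y hy =>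
    stronglyMeasurable_condExp.factorsThrough hy
  rw [setIntegral_congr_fun (hle _ hA) h2, setIntegral_const, smul_eq_mul] at h1
  rw [setAverage_eq, ← h1, smul_eq_mul, ← mul_assoc, inv_mul_cancel₀, one_mul]
  exact (measureReal_ne_zero_iff (by finiteness)).2 hx

/-- The inequality of Jensen for averages and powers. -/
theorem setLAverage_rpow_le [IsFiniteMeasure μ] {p : ℝ} (hp : 1 ≤ p) {f : Ω → ℝ}
    (hf : AEStronglyMeasurable f μ) (s : Set Ω) :
    (⨍⁻ y in s, ‖f y‖ₑ ∂μ) ^ p ≤ ⨍⁻ y in s, ‖f y‖ₑ ^ p ∂μ := by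
  have hp0 : 0 < p := by linarith
  by_cases hs : μ s = 0
  · simp [Measure.restrict_eq_zero.2 hs, hp0]
  · rw [laverage_eq', laverage_eq', Measure.restrict_apply_univ]
    have : IsProbabilityMeasure ((μ s)⁻¹ • μ.restrict s) :=
      ⟨by simp [ENNReal.inv_mul_cancel hs (measure_ne_top μ s)]⟩
    have h := eLpNorm'_le_eLpNorm'_of_exponent_le (f := f) zero_lt_one hp
      ((μ s)⁻¹ • μ.restrict s) (hf.restrict.smul_measure _)
    simp only [eLpNorm', ENNReal.rpow_one, one_div, inv_one] at h
    calc _ ≤ _ := ENNReal.rpow_le_rpow h hp0.le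
      _ = _ := by rw [← ENNReal.rpow_mul, inv_mul_cancel₀ hp0.ne', ENNReal.rpow_one]

/-- Let `φ` be a map with countably many values. If, inside each fiber of `φ`, the set `U` is at
most `L` times as large as `C`, then replacing `|f|` on `U` by its averages over the parts of `C`
in the fibers gives a function whose `p`-th power has integral at most `L ∫ |f| ^ p` over `C`. Only
the fibers over the set `W` are taken into account. -/
theorem lintegral_fiber_average_le [IsFiniteMeasure μ] [Countable ι] [MeasurableSingletonClass ι]
    {φ : Ω → ι} (hφ : Measurable φ) {p : ℝ} (hp : 1 ≤ p) {f : Ω → ℝ}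
    (hf : AEStronglyMeasurable f μ) {C U : Set Ω} (hC : MeasurableSet C) (hU : MeasurableSet U)
    {L : ENNReal} (hL : ∀ q, μ (φ ⁻¹' {q} ∩ U) ≤ L * μ (φ ⁻¹' {q} ∩ C)) (W : Set ι) :
    ∫⁻ x in U ∩ φ ⁻¹' W, (⨍⁻ y in φ ⁻¹' {φ x} ∩ C, ‖f y‖ₑ ∂μ) ^ p ∂μ ≤
      L * ∫⁻ x in C ∩ φ ⁻¹' W, ‖f x‖ₑ ^ p ∂μ := by
  have hW : MeasurableSet W := W.to_countable.measurableSet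
  have split : ∀ (A : Set Ω) (hA : MeasurableSet A) (g : Ω → ENNReal),
      ∫⁻ x in A ∩ φ ⁻¹' W, g x ∂μ = ∑' q : W, ∫⁻ x in φ ⁻¹' {q.1} ∩ A, g x ∂μ := by
    intro A hA g
    rw [← lintegral_iUnion (fun q : W => (hφ (measurableSet_singleton _)).inter hA)]
    · congr 2
      ext x
      simp [and_comm]
    · intro q r hqr
      refine Set.disjoint_left.2 fun x hx hy => hqr (Subtype.ext ?_)
      exact hx.1.symm.trans hy.1
  rw [split U hU, split C hC, ← ENNReal.tsum_mul_left]
  refine ENNReal.tsum_le_tsum fun q => ?_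
  have hm : MeasurableSet (φ ⁻¹' {q.1} ∩ U) := (hφ (measurableSet_singleton _)).inter hU
  have hconst : ∫⁻ x in φ ⁻¹' {q.1} ∩ U, (⨍⁻ y in φ ⁻¹' {φ x} ∩ C, ‖f y‖ₑ ∂μ) ^ p ∂μ =
      (⨍⁻ y in φ ⁻¹' {q.1} ∩ C, ‖f y‖ₑ ∂μ) ^ p * μ (φ ⁻¹' {q.1} ∩ U) := by
    rw [← setLIntegral_const]
    refine setLIntegral_congr_fun hm fun x hx => ?_
    have : φ x = q.1 := hx.1
    simp only [this]
  rw [hconst]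
  calc _ ≤ (⨍⁻ y in φ ⁻¹' {q.1} ∩ C, ‖f y‖ₑ ^ p ∂μ) * (L * μ (φ ⁻¹' {q.1} ∩ C)) := by
        gcongr
        · exact setLAverage_rpow_le hp hf _
        · exact hL _
    _ = L * (μ (φ ⁻¹' {q.1} ∩ C) * ⨍⁻ y in φ ⁻¹' {q.1} ∩ C, ‖f y‖ₑ ^ p ∂μ) := by ring
    _ = _ := by rw [measure_mul_setLAverage _ (by finiteness)]

end General

/-! ### The martingale of the fine cells -/

namespace Stages

variable (D : Stages)

/-- The fine code of `x` at stage `k` records the cell of `x` and which of the fresh coordinates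
lie in the distinguished arc. -/
noncomputable def fineCode (k : ℕ) (x : TorusOmega) :
    (Fin (D.start k) → ℕ) × (D.fresh k → Bool) :=
  (D.code k x, fun i => decide (dyadicIndex (D.depth k) (x i) = 0))

variable {D}

theorem measurable_fineCode (k : ℕ) : Measurable (D.fineCode k) := by
  refine (measurable_code k).prodMk (measurable_pi_lambda _ fun i => ?_)
  exact (measurable_from_nat (f := fun n => decide (n = 0))).comp
    ((measurable_dyadicIndex _).comp (measurable_pi_apply _))

theorem fineCode_factorsThrough (k : ℕ) :
    (D.fineCode k).FactorsThrough (D.code (k + 1)) := by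
  intro x y h
  have hs : ∀ i < D.start (k + 1), dyadicIndex (D.mesh (k + 1)) (x i) =
      dyadicIndex (D.mesh (k + 1)) (y i) := fun i hi => congrFun h ⟨i, hi⟩
  refine Prod.ext (funext fun i => ?_) (funext fun i => ?_)
  · exact dyadicIndex_congr (D.mesh_mono k.le_succ)
      (hs i (i.2.trans (D.start_strictMono k.lt_succ_self)))
  · simp only [fineCode]
    rw [dyadicIndex_congr (D.depth_le_mesh k.lt_succ_self) (hs i (D.mem_fresh.1 i.2).2)]

theorem comap_code_le_comap_fineCode (k : ℕ) :
    MeasurableSpace.comap (D.code k) inferInstance ≤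
      MeasurableSpace.comap (D.fineCode k) inferInstance :=
  (measurable_fst.comp (comap_measurable (D.fineCode k))).comap_le

theorem comap_fineCode_le_comap_code (k : ℕ) :
    MeasurableSpace.comap (D.fineCode k) inferInstance ≤
      MeasurableSpace.comap (D.code (k + 1)) inferInstance := by
  obtain ⟨g, hg⟩ := (Function.factorsThrough_iff _).1 (D.fineCode_factorsThrough k)
  rw [hg]
  exact ((Measurable.of_discrete (f := g)).comp (comap_measurable _)).comap_le

/-- The filtration generated by the fine codes. -/
noncomputable def filtration (D : Stages) :
    Filtration ℕ (inferInstance : MeasurableSpace TorusOmega) where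
  seq k := MeasurableSpace.comap (D.fineCode k) inferInstance
  mono' := monotone_nat_of_le_succ fun k =>
    (comap_fineCode_le_comap_code k).trans (comap_code_le_comap_fineCode (k + 1))
  le' k := (measurable_fineCode k).comap_le

theorem tendsto_dyadicIndex_div (t : UnitAddCircle) :
    Tendsto (fun k => (dyadicIndex (D.mesh k) t : ℝ) / 2 ^ D.mesh k) atTop
      (𝓝 (AddCircle.equivIco (1 : ℝ) 0 t : ℝ)) := by
  have h2 : Tendsto (fun k => (2 : ℝ) ^ D.mesh k) atTop atTop :=
    (tendsto_pow_atTop_atTop_of_one_lt one_lt_two).comp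
      (tendsto_atTop_mono D.le_mesh tendsto_id)
  refine ((tendsto_nat_floor_mul_div_atTop (equivIco_nonneg t)).comp h2).congr fun k => ?_
  simp [dyadicIndex, mul_comm]

theorem iSup_filtration : ⨆ k, D.filtration k = (inferInstance : MeasurableSpace TorusOmega) := by
  refine le_antisymm (iSup_le fun k => D.filtration.le k) ?_
  refine iSup_le fun i => Measurable.comap_le ?_
  have hrep : Measurable[⨆ k, D.filtration k]
      fun x : TorusOmega => (AddCircle.equivIco (1 : ℝ) 0 (x i) : ℝ) := by
    refine @measurable_of_tendsto_metrizable _ _ (⨆ k, D.filtration k) _ _ _ _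
      (fun k x => (if i < D.start k then (dyadicIndex (D.mesh k) (x i) : ℝ) / 2 ^ D.mesh k
        else 0)) _ (fun k => ?_) (tendsto_pi_nhds.2 fun x => ?_)
    · split_ifs with h
      · have h1 : Measurable fun c : Fin (D.start k) → ℕ => (c ⟨i, h⟩ : ℝ) / 2 ^ D.mesh k :=
          Measurable.of_discrete
        have h2 : MeasurableSpace.comap (D.code k) inferInstance ≤ ⨆ k, D.filtration k :=
          (comap_code_le_comap_fineCode k).trans
            (le_iSup (fun k => (D.filtration k : MeasurableSpace TorusOmega)) k)
        exact (h1.comp (comap_measurable (D.code k))).mono h2 le_rfl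
      · exact measurable_const
    · refine (tendsto_dyadicIndex_div (D := D) (x i)).congr' ?_
      filter_upwards [eventually_gt_atTop i] with k hk
      rw [if_pos (hk.trans_le (D.le_start k))]
  have : (fun x : TorusOmega => x i) =
      fun x => (((AddCircle.equivIco (1 : ℝ) 0 (x i) : ℝ)) : UnitAddCircle) := by
    funext x
    exact AddCircle.coe_equivIco.symm
  rw [this]
  exact (AddCircle.measurable_mk' (a := (1 : ℝ))).comp hrep

theorem tendsto_condExp_filtration {f : TorusOmega → ℝ} (hf : Integrable f torusMeasure) :
    ∀ᵐ x ∂torusMeasure,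
      Tendsto (fun k => (torusMeasure[f | D.filtration k]) x) atTop (𝓝 (f x)) := by
  have h := tendsto_ae_condExp (μ := torusMeasure) (ℱ := D.filtration) f
  rw [iSup_filtration] at h
  have h2 : torusMeasure[f | (inferInstance : MeasurableSpace TorusOmega)] =ᵐ[torusMeasure] f :=
    condExp_of_aestronglyMeasurable' le_rfl hf.aestronglyMeasurable hf
  filter_upwards [h, h2] with x hx hx2
  rwa [hx2] at hx

/-- Off the core, a beam over a cell is a fine cell. -/
theorem fineCode_fiber {k j : ℕ} (hj : j ∈ D.fresh k) {x : TorusOmega} (hx : x ∈ D.beam k j)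
    (hxc : x ∉ D.core k) : D.fineCode k ⁻¹' {D.fineCode k x} =
      (D.code k ⁻¹' {D.code k x} ∩ D.beam k j) \ (D.code k ⁻¹' {D.code k x} ∩ D.core k) := by
  have hxj : dyadicIndex (D.depth k) (x j) ≠ 0 := fun h => hxc <| mem_core.2 fun i hi => by
    by_cases hij : i = j
    · exact hij ▸ h
    · exact mem_beam.1 hx i hi hij
  ext y
  simp only [Set.mem_preimage, Set.mem_singleton_iff, fineCode, Prod.mk.injEq, Set.mem_sdiff,
    Set.mem_inter_iff, funext_iff, Subtype.forall, decide_eq_decide]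
  constructor
  · rintro ⟨h1, h2⟩
    refine ⟨⟨h1, mem_beam.2 fun i hi hij => (h2 i hi).2 (mem_beam.1 hx i hi hij)⟩, fun h => ?_⟩
    exact hxj ((h2 j hj).1 (mem_core.1 h.2 j hj))
  · rintro ⟨⟨h1, h2⟩, h3⟩
    refine ⟨h1, fun i hi => ?_⟩
    by_cases hij : i = j
    · subst hij
      refine iff_of_false (fun h => h3 ⟨h1, mem_core.2 fun l hl => ?_⟩) hxj
      by_cases hli : l = i
      · exact hli ▸ h
      · exact mem_beam.1 h2 l hl hli
    · exact iff_of_true (mem_beam.1 h2 i hi hij) (mem_beam.1 hx i hi hij)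

/-- The average of `f` over a rectangle is a convex combination of the average over the core part
and of the conditional expectation at any point of the rectangle outside the core. -/
theorem setAverage_rect {k j : ℕ} (hj : j ∈ D.fresh k) {f : TorusOmega → ℝ}
    (hf : Integrable f torusMeasure) {x : TorusOmega} (hx : x ∈ D.beam k j)
    (hxc : x ∉ D.core k) :
    ⨍ y in D.rect k j (D.code k x), f y ∂torusMeasure =
      (2 ^ D.depth k)⁻¹ * ⨍ y in D.code k ⁻¹' {D.code k x} ∩ D.core k, f y ∂torusMeasure +
      (1 - (2 ^ D.depth k)⁻¹) * (torusMeasure[f | D.filtration k]) x := by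
  set Q := D.code k ⁻¹' {D.code k x} with hQ
  have hC : MeasurableSet (Q ∩ D.core k) := (measurableSet_cell _ _).inter (measurableSet_core k)
  have hsub : Q ∩ D.core k ⊆ Q ∩ D.beam k j :=
    Set.inter_subset_inter_right _ (core_subset_beam k j)
  have hm0 : 0 < torusMeasure.real (Q ∩ D.core k) :=
    ENNReal.toReal_pos (measure_cell_inter_core_pos (code_lt k x)).ne' (by finiteness)
  have hmB : torusMeasure.real (Q ∩ D.beam k j) =
      2 ^ D.depth k * torusMeasure.real (Q ∩ D.core k) := by
    rw [measureReal_def, hQ, measure_cell_inter_beam hj, ENNReal.toReal_mul, measureReal_def]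
    simp
  have hmD : torusMeasure.real ((Q ∩ D.beam k j) \ (Q ∩ D.core k)) =
      (2 ^ D.depth k - 1) * torusMeasure.real (Q ∩ D.core k) := by
    rw [measureReal_sdiff hsub hC, hmB]; ring
  have h2 : (1 : ℝ) < 2 ^ D.depth k := one_lt_pow₀ one_lt_two (D.depth_pos k).ne'
  have hE : (torusMeasure[f | D.filtration k]) x =
      ⨍ y in (Q ∩ D.beam k j) \ (Q ∩ D.core k), f y ∂torusMeasure := by
    rw [← fineCode_fiber hj hx hxc]
    refine condExp_comap_eq_setAverage (measurable_fineCode k) hf ?_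
    rw [fineCode_fiber hj hx hxc, ← hQ]
    refine (measureReal_ne_zero_iff (by finiteness)).1 ?_
    rw [hmD]
    have : (0 : ℝ) < 2 ^ D.depth k - 1 := by linarith
    positivity
  rw [hE, setAverage_congr (rect_ae_eq hj (code_lt k x)), setAverage_eq, setAverage_eq,
    setAverage_eq, ← hQ, hmB, hmD, ← integral_inter_add_sdiff hC hf.integrableOn,
    Set.inter_eq_right.2 hsub]
  simp only [smul_eq_mul]
  have h3 : (2 : ℝ) ^ D.depth k - 1 ≠ 0 := by linarith
  field_simp

end Stages
end TorusBeam

/-! ### Differentiation -/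

namespace TorusBeam
namespace Stages

variable {D : Stages}

/-- The averages over the core parts, divided by `2 ^ depth k`, that occur in the averages over
the rectangles of stage `k` containing `x` tend to zero. The reason is that their `p`-th powers
have a finite sum of integrals, once the cells meeting a core of a stage between `K` and `k`
are discarded: what is left of the cores is pairwise disjoint. -/
theorem tendsto_core_average {p : ℝ} (hp : 1 ≤ p) {A : ENNReal} (hA : A ≠ ⊤)
    (hDA : ∀ k, (D.width k : ENNReal) * 2 ^ D.depth k ≤ A * ((2 : ENNReal) ^ D.depth k) ^ p)
    (hcore : ∑' k, torusMeasure (D.core k) ≠ ⊤)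
    {f : TorusOmega → ℝ} (hf : MemLp f (ENNReal.ofReal p) torusMeasure) :
    ∀ᵐ x ∂torusMeasure, Tendsto (fun k => (D.reach k).indicator (fun x =>
      ((2 : ENNReal) ^ D.depth k)⁻¹ *
        ⨍⁻ y in D.code k ⁻¹' {D.code k x} ∩ D.core k, ‖f y‖ₑ ∂torusMeasure) x)
      atTop (𝓝 0) := by
  have hp0 : 0 < p := by linarith
  have hfp : ∫⁻ x, ‖f x‖ₑ ^ p ∂torusMeasure < ⊤ := by
    have := lintegral_rpow_enorm_lt_top_of_eLpNorm_lt_top (by simpa using hp0) ENNReal.ofReal_ne_top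
      hf.eLpNorm_lt_top
    rwa [ENNReal.toReal_ofReal hp0.le] at this
  -- the points outside the cores of the stages between `K` and `k`
  let Z : ℕ → ℕ → Set TorusOmega := fun K k => {x | ∀ i, K ≤ i → i < k → x ∉ D.core i}
  have hZ : ∀ K k, Z K k = D.code k ⁻¹' (D.code k '' Z K k) := by
    intro K k
    refine Set.Subset.antisymm (Set.subset_preimage_image _ _) ?_
    rintro x ⟨y, hy, hyx⟩ i hKi hik
    rw [← mem_core_congr hik hyx]
    exact hy i hKi hik
  have hZm : ∀ K k, MeasurableSet (Z K k) := fun K k => by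
    rw [hZ]
    exact measurable_code k (Set.to_countable _).measurableSet
  let h : ℕ → TorusOmega → ENNReal := fun k x =>
    ⨍⁻ y in D.code k ⁻¹' {D.code k x} ∩ D.core k, ‖f y‖ₑ ∂torusMeasure
  have hhm : ∀ k, Measurable (h k) := fun k =>
    (Measurable.of_discrete (f := fun c =>
      ⨍⁻ y in D.code k ⁻¹' {c} ∩ D.core k, ‖f y‖ₑ ∂torusMeasure)).comp (measurable_code k)
  let e : ℕ → ℕ → TorusOmega → ENNReal := fun K k =>
    (D.reach k ∩ Z K k).indicator fun x => (((2 : ENNReal) ^ D.depth k)⁻¹ * h k x) ^ p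
  have hem : ∀ K k, Measurable (e K k) := fun K k =>
    (((hhm k).const_mul _).pow_const p).indicator ((measurableSet_reach k).inter (hZm K k))
  have hstep : ∀ K k, ∫⁻ x, e K k x ∂torusMeasure ≤
      A * ∫⁻ x in D.core k ∩ Z K k, ‖f x‖ₑ ^ p ∂torusMeasure := by
    intro K k
    have hpow : ((2 : ENNReal) ^ D.depth k) ^ p ≠ 0 := by
      rw [← pos_iff_ne_zero]
      exact ENNReal.rpow_pos (by positivity) (by finiteness)
    have hpow' : ((2 : ENNReal) ^ D.depth k) ^ p ≠ ⊤ :=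
      ENNReal.rpow_ne_top_of_nonneg hp0.le (by finiteness)
    rw [lintegral_indicator ((measurableSet_reach k).inter (hZm K k))]
    simp_rw [ENNReal.mul_rpow_of_nonneg _ _ hp0.le, ENNReal.inv_rpow]
    rw [lintegral_const_mul _ ((hhm k).pow_const p), hZ]
    calc _ ≤ (((2 : ENNReal) ^ D.depth k) ^ p)⁻¹ * ((D.width k * 2 ^ D.depth k) *
          ∫⁻ x in D.core k ∩ D.code k ⁻¹' (D.code k '' Z K k), ‖f x‖ₑ ^ p ∂torusMeasure) := by
          gcongr
          exact lintegral_fiber_average_le (measurable_code k) hp hf.aestronglyMeasurable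
            (measurableSet_core k) (measurableSet_reach k) (measure_cell_inter_reach_le k) _
      _ ≤ (((2 : ENNReal) ^ D.depth k) ^ p)⁻¹ * ((A * ((2 : ENNReal) ^ D.depth k) ^ p) *
          ∫⁻ x in D.core k ∩ D.code k ⁻¹' (D.code k '' Z K k), ‖f x‖ₑ ^ p ∂torusMeasure) := by
          exact mul_le_mul' le_rfl (mul_le_mul' (hDA k) le_rfl)
      _ = ((((2 : ENNReal) ^ D.depth k) ^ p)⁻¹ * ((2 : ENNReal) ^ D.depth k) ^ p) * (A *
          ∫⁻ x in D.core k ∩ D.code k ⁻¹' (D.code k '' Z K k), ‖f x‖ₑ ^ p ∂torusMeasure) := by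
          ring
      _ = _ := by rw [ENNReal.inv_mul_cancel hpow hpow', one_mul]
  have hsum : ∀ K, ∀ᵐ x ∂torusMeasure, ∑' l, e K (K + l) x ≠ ⊤ := by
    intro K
    have hlt : ∫⁻ x, ∑' l, e K (K + l) x ∂torusMeasure < ⊤ := by
      rw [lintegral_tsum fun l => (hem K (K + l)).aemeasurable]
      calc _ ≤ ∑' l, A * ∫⁻ x in D.core (K + l) ∩ Z K (K + l), ‖f x‖ₑ ^ p ∂torusMeasure :=
            ENNReal.tsum_le_tsum fun l => hstep K (K + l)
        _ = A * ∫⁻ x in ⋃ l, D.core (K + l) ∩ Z K (K + l), ‖f x‖ₑ ^ p ∂torusMeasure := by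
            rw [ENNReal.tsum_mul_left, lintegral_iUnion
              fun l => (measurableSet_core _).inter (hZm _ _)]
            refine (pairwise_disjoint_on _).2 fun a b hab => Set.disjoint_left.2 fun x ha hb => ?_
            exact hb.2 (K + a) (Nat.le_add_right _ _) (Nat.add_lt_add_left hab K) ha.1
        _ ≤ A * ∫⁻ x, ‖f x‖ₑ ^ p ∂torusMeasure := by
            gcongr
            exact Measure.restrict_le_self
        _ < ⊤ := ENNReal.mul_lt_top hA.lt_top hfp
    filter_upwards [ae_lt_top (Measurable.tsum fun l => hem K (K + l)) hlt.ne] with x hx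
      using hx.ne
  filter_upwards [ae_all_iff.2 hsum, ae_eventually_notMem hcore] with x hx hxc
  obtain ⟨K, hK⟩ := eventually_atTop.1 hxc
  have h0 := ENNReal.tendsto_atTop_zero_of_tsum_ne_top (hx K)
  have h1 : Tendsto (fun k => e K k x) atTop (𝓝 0) := by
    rw [← tendsto_add_atTop_iff_nat K]
    simpa only [add_comm K] using h0
  have h2 := h1.ennrpow_const p⁻¹
  rw [ENNReal.zero_rpow_of_pos (inv_pos.2 hp0)] at h2
  refine h2.congr fun k => ?_
  have hxZ : x ∈ Z K k := fun i hi _ => hK i hi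
  by_cases hxr : x ∈ D.reach k
  · simp only [e]
    rw [Set.indicator_of_mem (Set.mem_inter hxr hxZ), Set.indicator_of_mem hxr,
      ← ENNReal.rpow_mul, mul_inv_cancel₀ hp0.ne', ENNReal.rpow_one]
  · simp only [e]
    rw [Set.indicator_of_notMem (fun h => hxr h.1), Set.indicator_of_notMem hxr,
      ENNReal.zero_rpow_of_pos (inv_pos.2 hp0)]

theorem differentiatesLp_basis {p : ℝ} (hp : 1 ≤ p) {A : ENNReal} (hA : A ≠ ⊤)
    (hDA : ∀ k, (D.width k : ENNReal) * 2 ^ D.depth k ≤ A * ((2 : ENNReal) ^ D.depth k) ^ p)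
    (hcore : ∑' k, torusMeasure (D.core k) ≠ ⊤) (hdepth : Tendsto D.depth atTop atTop) :
    DifferentiatesLp torusDist torusMeasure D.basis (ENNReal.ofReal p) := by
  intro f hf
  have hfi : Integrable f torusMeasure := hf.integrable (by simpa using hp)
  filter_upwards [tendsto_core_average hp hA hDA hcore hf, tendsto_condExp_filtration (D := D) hfi,
    ae_eventually_notMem hcore] with x hx hE hxc S hS
  choose k j hj c hc hSk using fun n => (hS.1 n).1
  have hk : Tendsto k atTop atTop := tendsto_stage hS fun n => ⟨j n, c n, hSk n⟩
  have hxb : ∀ n, D.code (k n) x = c n ∧ x ∈ D.beam (k n) (j n) := fun n =>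
    rect_subset (hj n) (hc n) (hSk n ▸ (hS.1 n).2)
  have hinv : Tendsto (fun n => ((2 : ℝ) ^ D.depth (k n))⁻¹) atTop (𝓝 0) :=
    ((tendsto_pow_atTop_atTop_of_one_lt one_lt_two).comp
      (hdepth.comp hk)).inv_tendsto_atTop
  -- the contribution of the core
  have h1 : Tendsto (fun n => (2 ^ D.depth (k n))⁻¹ *
      ⨍ y in D.code (k n) ⁻¹' {D.code (k n) x} ∩ D.core (k n), f y ∂torusMeasure)
      atTop (𝓝 0) := by
    refine squeeze_zero_norm (fun n => ?_)
      ((ENNReal.tendsto_toReal ENNReal.zero_ne_top).comp (hx.comp hk))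
    simp only [Function.comp_apply]
    rw [Set.indicator_of_mem (mem_reach.2 ⟨j n, hj n, (hxb n).2⟩), norm_mul, ENNReal.toReal_mul]
    gcongr
    · simp
    · rw [setLAverage_eq, setAverage_eq, norm_smul, norm_inv, Real.norm_of_nonneg measureReal_nonneg,
        ENNReal.toReal_div, div_eq_inv_mul, measureReal_def]
      gcongr
      refine (norm_integral_le_integral_norm _).trans_eq ?_
      rw [integral_norm_eq_lintegral_enorm hfi.aestronglyMeasurable.restrict]
  have h2 : Tendsto (fun n => (1 - ((2 : ℝ) ^ D.depth (k n))⁻¹) *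
      (torusMeasure[f | D.filtration (k n)]) x) atTop (𝓝 ((1 - 0) * f x)) :=
    (tendsto_const_nhds.sub hinv).mul (hE.comp hk)
  have h3 := h1.add h2
  rw [sub_zero, one_mul, zero_add] at h3
  refine h3.congr' ?_
  filter_upwards [hk.eventually hxc] with n hn
  rw [← setAverage_rect (hj n) hfi (hxb n).2 hn, hSk n, (hxb n).1]

end Stages
end TorusBeam

/-! ### Failure of differentiation -/

namespace TorusBeam
namespace Stages

variable {D : Stages}

theorem measure_beam_eq {k j : ℕ} (hj : j ∈ D.fresh k) :
    torusMeasure (D.beam k j) = 2 ^ D.depth k * torusMeasure (D.core k) := by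
  rw [measure_beam hj, measure_core]
  obtain ⟨n, hn⟩ := Nat.exists_eq_add_of_le' (D.width_pos k)
  rw [hn, Nat.add_sub_cancel, pow_succ', ← mul_assoc, ENNReal.mul_inv_cancel (by positivity)
    (by finiteness), one_mul]

/-- The beams of a stage overlap in the core only, and each of them is at least twice as large as
the core, so that the measure of their union is comparable to the sum of their measures. -/
theorem le_measure_reach (k : ℕ) :
    D.width k * 2 ^ D.depth k * torusMeasure (D.core k) ≤ 2 * torusMeasure (D.reach k) := by
  have hone : ∀ j ∈ D.fresh k, 2 ^ D.depth k * torusMeasure (D.core k) ≤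
      2 * torusMeasure (D.beam k j \ D.core k) := by
    intro j hj
    have h1 : torusMeasure (D.beam k j \ D.core k) + torusMeasure (D.core k) =
        2 ^ D.depth k * torusMeasure (D.core k) := by
      rw [← measure_beam_eq hj, ← measure_sdiff_add_inter (D.beam k j) (measurableSet_core k),
        Set.inter_eq_right.2 (core_subset_beam k j)]
    have h2 : 2 * torusMeasure (D.core k) ≤ 2 ^ D.depth k * torusMeasure (D.core k) := by
      gcongr
      calc (2 : ENNReal) = 2 ^ 1 := (pow_one _).symm
        _ ≤ _ := pow_le_pow_right₀ (by norm_num) (D.depth_pos k)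
    have h3 : torusMeasure (D.core k) ≤ torusMeasure (D.beam k j \ D.core k) := by
      rw [← h1, two_mul] at h2
      exact (ENNReal.add_le_add_iff_right (by finiteness)).1 h2
    rw [← h1, two_mul]
    gcongr
  calc _ = ∑ j ∈ D.fresh k, 2 ^ D.depth k * torusMeasure (D.core k) := by
        rw [Finset.sum_const, card_fresh, nsmul_eq_mul, mul_assoc]
    _ ≤ ∑ j ∈ D.fresh k, 2 * torusMeasure (D.beam k j \ D.core k) := Finset.sum_le_sum hone
    _ = 2 * torusMeasure (⋃ j ∈ D.fresh k, D.beam k j \ D.core k) := by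
        rw [← Finset.mul_sum, measure_biUnion_finset _
          fun j _ => (measurableSet_beam _ _).diff (measurableSet_core _)]
        intro a ha b hb hab
        refine Set.disjoint_left.2 fun x hxa hxb => hxa.2 (mem_core.2 fun i hi => ?_)
        by_cases hia : i = a
        · exact mem_beam.1 hxb.1 i hi (hia ▸ hab)
        · exact mem_beam.1 hxa.1 i hi hia
    _ ≤ _ := by
        gcongr
        exact Set.iUnion₂_mono fun j _ => Set.sdiff_subset

theorem iIndepSet_reach (D : Stages) : ProbabilityTheory.iIndepSet D.reach torusMeasure := by
  classical
  rw [ProbabilityTheory.iIndepSet_iff_meas_biInter measurableSet_reach]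
  -- the σ-algebras generated by the coordinates
  let m : ℕ → MeasurableSpace TorusOmega := fun i =>
    MeasurableSpace.comap (fun x => x i) inferInstance
  have hm : ∀ i, m i ≤ MeasurableSpace.pi := fun i => (measurable_pi_apply i).comap_le
  have hfun : ProbabilityTheory.iIndepFun (fun (i : ℕ) (x : TorusOmega) => x i) torusMeasure :=
    ProbabilityTheory.iIndepFun_infinitePi (Ω := fun _ : ℕ => UnitAddCircle)
      (𝓧 := fun _ : ℕ => UnitAddCircle) (P := fun _ => volume) (X := fun _ t => t)
      fun _ => measurable_id
  have hindep : ProbabilityTheory.iIndep m torusMeasure := hfun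
  have hreach : ∀ k (T : Set ℕ), (D.fresh k : Set ℕ) ⊆ T →
      MeasurableSet[⨆ i ∈ T, m i] (D.reach k) := by
    intro k T hT
    refine Finset.measurableSet_biUnion _ fun j _ => ?_
    rw [beam, Set.pi_def]
    refine MeasurableSet.biInter (Finset.countable_toSet _) fun i hi => ?_
    have hi' : i ∈ T := hT (Finset.mem_of_mem_erase hi)
    exact (le_iSup₂ (f := fun i (_ : i ∈ T) => m i) i hi') _
      ⟨_, measurableSet_dyadicArc (D.depth k) 0, rfl⟩
  intro s
  induction s using Finset.induction_on with
  | empty => simp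
  | insert k s hk ih =>
    rw [Finset.set_biInter_insert, Finset.prod_insert hk, ← ih]
    have hdisj : Disjoint (D.fresh k : Set ℕ) (⋃ l ∈ s, (D.fresh l : Set ℕ)) := by
      refine Set.disjoint_left.2 fun i hi hi' => ?_
      obtain ⟨l, hl, hil⟩ := Set.mem_iUnion₂.1 hi'
      have h1 := D.mem_fresh.1 (Finset.mem_coe.1 hi)
      have h2 := D.mem_fresh.1 (Finset.mem_coe.1 hil)
      have hkl : k ≠ l := fun h => hk (h ▸ hl)
      have h3 : k < l + 1 := D.start_strictMono.lt_iff_lt.1 (h1.1.trans_lt h2.2)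
      have h4 : l < k + 1 := D.start_strictMono.lt_iff_lt.1 (h2.1.trans_lt h1.2)
      omega
    refine (ProbabilityTheory.Indep_iff _ _ _).1
      (ProbabilityTheory.indep_iSup_of_disjoint hm hindep hdisj) _ _ ?_ ?_
    · exact hreach k _ Set.Subset.rfl
    · exact MeasurableSet.biInter (Finset.countable_toSet _) fun l hl =>
        hreach l _ (Set.subset_biUnion_of_mem (u := fun l => (D.fresh l : Set ℕ)) hl)

theorem ae_frequently_mem_reach
    (h : ∑' k, (D.width k : ENNReal) * 2 ^ D.depth k * torusMeasure (D.core k) = ⊤) :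
    ∀ᵐ x ∂torusMeasure, ∃ᶠ k in atTop, x ∈ D.reach k := by
  have hsum : ∑' k, torusMeasure (D.reach k) = ⊤ := by
    have h1 : ∑' k, 2 * torusMeasure (D.reach k) = ⊤ :=
      top_le_iff.1 (h ▸ ENNReal.tsum_le_tsum le_measure_reach)
    rw [ENNReal.tsum_mul_left] at h1
    by_contra hne
    exact ENNReal.mul_ne_top (by finiteness) hne h1
  have := ProbabilityTheory.measure_limsup_eq_one measurableSet_reach D.iIndepSet_reach hsum
  have h2 : ∀ᵐ x ∂torusMeasure, x ∈ limsup D.reach atTop :=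
    (mem_ae_iff_prob_eq_one (MeasurableSet.measurableSet_limsup measurableSet_reach)).2 this
  filter_upwards [h2] with x hx
  exact mem_limsup_iff_frequently_mem.1 hx

/-- If `f` is at least `2 ^ depth k` on the core, then its average over any rectangle of stage `k`
is at least one. -/
theorem one_le_setAverage {f : TorusOmega → ℝ} (hf : Integrable f torusMeasure) (hf0 : 0 ≤ f)
    (hcore : ∀ᵐ x ∂torusMeasure, ∀ k, x ∈ D.core k → (2 : ℝ) ^ D.depth k ≤ f x)
    {R : Set TorusOmega} {x : TorusOmega} (hR : R ∈ D.basis x) :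
    1 ≤ ⨍ y in R, f y ∂torusMeasure := by
  obtain ⟨⟨k, j, hj, c, hc, rfl⟩, -⟩ := hR
  have hreal : torusMeasure.real (D.rect k j c) =
      2 ^ D.depth k * torusMeasure.real (D.code k ⁻¹' {c} ∩ D.core k) := by
    rw [measureReal_def, measure_rect hj hc, ENNReal.toReal_mul, measureReal_def]
    simp
  have hpos : 0 < torusMeasure.real (D.rect k j c) := by
    rw [hreal]
    have := ENNReal.toReal_pos (measure_cell_inter_core_pos hc).ne' (by finiteness)
    rw [measureReal_def]
    positivity
  rw [setAverage_eq, smul_eq_mul, ← div_eq_inv_mul, one_le_div hpos,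
    setIntegral_congr_set (rect_ae_eq hj hc)]
  calc torusMeasure.real (D.rect k j c)
      = ∫ _ in D.code k ⁻¹' {c} ∩ D.core k, (2 : ℝ) ^ D.depth k ∂torusMeasure := by
        rw [setIntegral_const, smul_eq_mul, hreal, mul_comm]
    _ ≤ ∫ y in D.code k ⁻¹' {c} ∩ D.core k, f y ∂torusMeasure := by
        refine setIntegral_mono_on_ae (integrable_const _).integrableOn hf.integrableOn
          ((measurableSet_cell _ _).inter (measurableSet_core _)) ?_
        filter_upwards [hcore] with y hy hyc using hy k hyc.2
    _ ≤ _ := setIntegral_mono_set hf.integrableOn (ae_of_all _ hf0)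
        (Set.inter_subset_inter_right _ (core_subset_beam k j)).eventuallyLE

/-- Differentiation fails for a function that is at least `2 ^ depth k` on the core of every
stage `k` and vanishes off the cores. -/
theorem not_differentiatesLp_basis {p : ℝ} (hp : 1 ≤ p)
    (hsum : ∑' k, ((2 : ENNReal) ^ D.depth k) ^ p * torusMeasure (D.core k) ≠ ⊤)
    (hcore : ∑' k, torusMeasure (D.core k) < 1)
    (hB : IsBusemannFellerBasis torusDist torusMeasure D.basis) :
    ¬ DifferentiatesLp torusDist torusMeasure D.basis (ENNReal.ofReal p) := by
  intro hD
  have hp0 : 0 < p := by linarith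
  -- `f ^ p` is a sum over the stages, so its integral can be computed although the cores overlap
  let g : TorusOmega → ENNReal := fun x =>
    ∑' k, (D.core k).indicator (fun _ => ((2 : ENNReal) ^ D.depth k) ^ p) x
  have hgm : Measurable g := Measurable.tsum fun k =>
    measurable_const.indicator (measurableSet_core k)
  have hg : ∫⁻ x, g x ∂torusMeasure ≠ ⊤ := by
    rw [lintegral_tsum fun k => (measurable_const.indicator (measurableSet_core k)).aemeasurable]
    simpa only [lintegral_indicator_const (measurableSet_core _)] using hsum
  let f : TorusOmega → ℝ := fun x => (g x ^ p⁻¹).toReal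
  have hf0 : 0 ≤ f := fun x => ENNReal.toReal_nonneg
  have hfL : MemLp f (ENNReal.ofReal p) torusMeasure := by
    refine ⟨(hgm.pow_const _).ennreal_toReal.aestronglyMeasurable, ?_⟩
    rw [eLpNorm_lt_top_iff_lintegral_rpow_enorm_lt_top (by simpa using hp0) ENNReal.ofReal_ne_top,
      ENNReal.toReal_ofReal hp0.le]
    refine (lintegral_mono fun x => ?_).trans_lt hg.lt_top
    calc ‖f x‖ₑ ^ p ≤ (g x ^ p⁻¹) ^ p := by
          gcongr
          rw [Real.enorm_of_nonneg (hf0 x)]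
          exact ENNReal.ofReal_toReal_le
      _ = g x := by rw [← ENNReal.rpow_mul, inv_mul_cancel₀ hp0.ne', ENNReal.rpow_one]
  have hfi : Integrable f torusMeasure := hfL.integrable (by simpa using hp)
  have hfcore : ∀ᵐ x ∂torusMeasure, ∀ k, x ∈ D.core k → (2 : ℝ) ^ D.depth k ≤ f x := by
    filter_upwards [ae_lt_top hgm hg] with x hx k hxk
    have h1 : ((2 : ENNReal) ^ D.depth k) ^ p ≤ g x := by
      refine le_trans ?_ (ENNReal.le_tsum k)
      rw [Set.indicator_of_mem hxk]
    have h2 : (2 : ENNReal) ^ D.depth k ≤ g x ^ p⁻¹ := by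
      calc _ = (((2 : ENNReal) ^ D.depth k) ^ p) ^ p⁻¹ := by
            rw [← ENNReal.rpow_mul, mul_inv_cancel₀ hp0.ne', ENNReal.rpow_one]
        _ ≤ _ := by gcongr
    have h3 := ENNReal.toReal_mono
      (ENNReal.rpow_ne_top_of_nonneg (inv_nonneg.2 hp0.le) hx.ne) h2
    simpa using h3
  have hall : ∀ᵐ x ∂torusMeasure, x ∈ ⋃ k, D.core k := by
    filter_upwards [hD f hfL, hB.exists_contractsTo] with x hx ⟨S, hS⟩
    by_contra hxc
    have hfx : f x = 0 := by
      have : g x = 0 := ENNReal.tsum_eq_zero.2 fun k =>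
        Set.indicator_of_notMem (fun h => hxc (Set.mem_iUnion.2 ⟨k, h⟩)) _
      simp [f, this, hp0]
    have := ge_of_tendsto' (hx S hS) fun n => one_le_setAverage hfi hf0 hfcore (hS.1 n)
    linarith
  have hone := (mem_ae_iff_prob_eq_one
    (MeasurableSet.iUnion fun k => measurableSet_core k)).1 hall
  exact absurd (hone ▸ measure_iUnion_le D.core) (not_le.2 hcore)

end Stages
end TorusBeam

/-! ### Choice of the parameters -/

namespace TorusBeam

theorem exists_nat_mul_mem_Icc {w : ENNReal} (h0 : w ≠ 0) (h1 : w ≤ 1) :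
    ∃ L : ℕ, 1 ≤ L * w ∧ L * w ≤ 2 := by
  lift w to NNReal using ne_top_of_le_ne_top ENNReal.one_ne_top h1
  have h0' : 0 < w := pos_iff_ne_zero.2 (by exact_mod_cast h0)
  have h1' : w ≤ 1 := by exact_mod_cast h1
  refine ⟨⌈w⁻¹⌉₊, ?_, ?_⟩
  · have : 1 ≤ (⌈w⁻¹⌉₊ : NNReal) * w := by
      calc 1 = w⁻¹ * w := (inv_mul_cancel₀ h0'.ne').symm
        _ ≤ _ := by gcongr; exact Nat.le_ceil _
    exact_mod_cast this
  · have : (⌈w⁻¹⌉₊ : NNReal) * w ≤ 2 := by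
      calc _ ≤ (w⁻¹ + 1) * w := by gcongr; exact (Nat.ceil_lt_add_one zero_le).le
        _ = 1 + w := by rw [add_mul, inv_mul_cancel₀ h0'.ne', one_mul]
        _ ≤ 1 + 1 := by gcongr
        _ = 2 := one_add_one_eq_two
    exact_mod_cast this

/-- There is a sequence of natural numbers in which each `m` occurs exactly `L m` times. -/
theorem exists_enumeration_with_multiplicity (L : ℕ → ℕ) (hL : ∀ m, 0 < L m) :
    ∃ τ : ℕ → ℕ, Tendsto τ atTop atTop ∧
      ∀ G : ℕ → ENNReal, ∑' k, G (τ k) = ∑' m, L m * G m := by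
  have : Infinite (Σ m, Fin (L m)) :=
    Infinite.of_injective (fun m => ⟨m, ⟨0, hL m⟩⟩) fun a b h => congrArg Sigma.fst h
  obtain ⟨e⟩ := nonempty_equiv_of_countable (α := ℕ) (β := Σ m, Fin (L m))
  refine ⟨fun k => (e k).1, ?_, fun G => ?_⟩
  · rw [← Nat.cofinite_eq_atTop]
    refine Tendsto.comp (g := Sigma.fst) ?_ e.injective.tendsto_cofinite
    refine tendsto_def.2 fun s hs => ?_
    rw [mem_cofinite, ← Set.preimage_compl] at *
    refine Set.Finite.subset (hs.toFinset.sigma fun m => (Finset.univ : Finset (Fin (L m)))).finite_toSet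
      fun x hx => ?_
    simpa using hx
  · rw [e.tsum_eq (fun s : Σ m, Fin (L m) => G s.1), ENNReal.tsum_sigma (fun m (_ : Fin (L m)) => G m)]
    refine tsum_congr fun m => ?_
    simp

/-- The stages of the construction, for stages of type `m` with `P m` fresh coordinates and depth
`m + 3`. Each type is repeated so often that the reaches of the stages of this type have total
measure about one. The depth starts at three so that the cores together have measure below one. -/
theorem exists_stages (P : ℕ → ℕ) (hP : ∀ m, 0 < P m) :
    ∃ (D : Stages) (τ : ℕ → ℕ), (∀ k, D.width k = P (τ k)) ∧ (∀ k, D.depth k = τ k + 3) ∧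
      Tendsto D.depth atTop atTop ∧ ∑' k, torusMeasure (D.core k) < 1 ∧
      ∑' k, (D.width k : ENNReal) * 2 ^ D.depth k * torusMeasure (D.core k) = ⊤ ∧
      ∀ p : ℝ, ∑' m, ((2 : ENNReal) ^ (m + 3)) ^ p * ((P m : ENNReal) * 2 ^ (m + 3))⁻¹ ≠ ⊤ →
        ∑' k, ((2 : ENNReal) ^ D.depth k) ^ p * torusMeasure (D.core k) ≠ ⊤ := by
  -- the measure of the core of a stage of type `m`
  let κ : ℕ → ENNReal := fun m => ((2 : ENNReal) ^ (m + 3))⁻¹ ^ P m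
  have hκ0 : ∀ m, κ m ≠ 0 := fun m => pow_ne_zero _ (ENNReal.inv_ne_zero.2 (by finiteness))
  have hw0 : ∀ m, (P m : ENNReal) * 2 ^ (m + 3) ≠ 0 := fun m =>
    mul_ne_zero (by exact_mod_cast (hP m).ne') (by positivity)
  have hw1 : ∀ m, (P m * 2 ^ (m + 3)) * κ m ≤ 1 := by
    intro m
    obtain ⟨n, hn⟩ := Nat.exists_eq_add_of_le' (hP m)
    have h1 : (P m : ENNReal) ≤ (2 ^ (m + 3)) ^ n := by
      calc (P m : ENNReal) ≤ 2 ^ n := by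
            rw [hn]; exact_mod_cast Nat.lt_two_pow_self
        _ ≤ _ := by
            gcongr
            exact le_self_pow₀ (by norm_num) (by omega)
    calc (P m * 2 ^ (m + 3)) * κ m ≤ ((2 ^ (m + 3)) ^ n * 2 ^ (m + 3)) * κ m := by gcongr
      _ = 1 := by
          simp only [κ]
          rw [hn, ← pow_succ, ← mul_pow, ENNReal.mul_inv_cancel (by positivity) (by finiteness),
            one_pow]
  choose L hL1 hL2 using fun m => exists_nat_mul_mem_Icc (mul_ne_zero (hw0 m) (hκ0 m)) (hw1 m)
  have hLpos : ∀ m, 0 < L m := fun m => Nat.pos_of_ne_zero fun h => by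
    have := hL1 m
    rw [h] at this
    simp at this
  obtain ⟨τ, hτ, hsum⟩ := exists_enumeration_with_multiplicity L hLpos
  have hLκ : ∀ m, L m * κ m ≤ 2 * ((P m : ENNReal) * 2 ^ (m + 3))⁻¹ := by
    intro m
    rw [← div_eq_mul_inv, ENNReal.le_div_iff_mul_le (Or.inl (hw0 m)) (Or.inl (by finiteness))]
    calc _ = L m * ((P m * 2 ^ (m + 3)) * κ m) := by ring
      _ ≤ 2 := hL2 m
  let D : Stages :=
    { width := fun k => P (τ k)
      depth := fun k => τ k + 3
      width_pos := fun k => hP _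
      depth_pos := fun k => Nat.succ_pos _ }
  have hcore : ∀ k, torusMeasure (D.core k) = κ (τ k) := fun k => Stages.measure_core k
  refine ⟨D, τ, fun _ => rfl, fun _ => rfl, tendsto_atTop_mono (fun k => Nat.le_add_right _ _) hτ, ?_, ?_, ?_⟩
  · simp_rw [hcore]
    rw [hsum κ]
    calc ∑' m, L m * κ m ≤ ∑' m : ℕ, 2 * (2⁻¹ ^ 3 * 2⁻¹ ^ m) := by
          refine ENNReal.tsum_le_tsum fun m => (hLκ m).trans ?_
          rw [← pow_add, ← ENNReal.inv_pow, add_comm 3 m]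
          gcongr
          exact le_mul_of_one_le_left zero_le (by exact_mod_cast hP m)
      _ = 2 * (2⁻¹ ^ 3 * 2) := by
          rw [ENNReal.tsum_mul_left, ENNReal.tsum_mul_left, ENNReal.tsum_geometric_two]
      _ < 1 := by
          rw [← ENNReal.toReal_lt_toReal (by finiteness) (by finiteness)]
          simp
          norm_num
  · have h1 : ∑' k, (D.width k : ENNReal) * 2 ^ D.depth k * torusMeasure (D.core k) =
        ∑' k, (fun m => P m * 2 ^ (m + 3) * κ m) (τ k) :=
      tsum_congr fun k => by rw [hcore]
    rw [h1, hsum fun m => P m * 2 ^ (m + 3) * κ m, ← top_le_iff]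
    calc (⊤ : ENNReal) = ∑' _ : ℕ, 1 := (ENNReal.tsum_const_eq_top_of_ne_zero one_ne_zero).symm
      _ ≤ _ := ENNReal.tsum_le_tsum hL1
  · intro p hp
    have h1 : ∑' k, ((2 : ENNReal) ^ D.depth k) ^ p * torusMeasure (D.core k) =
        ∑' k, (fun m => ((2 : ENNReal) ^ (m + 3)) ^ p * κ m) (τ k) :=
      tsum_congr fun k => by rw [hcore]
    rw [h1, hsum fun m => ((2 : ENNReal) ^ (m + 3)) ^ p * κ m]
    refine ne_top_of_le_ne_top (ENNReal.mul_ne_top (ENNReal.ofNat_ne_top (n := 2)) hp) ?_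
    rw [← ENNReal.tsum_mul_left]
    refine ENNReal.tsum_le_tsum fun m => ?_
    calc _ = ((2 : ENNReal) ^ (m + 3)) ^ p * (L m * κ m) := by ring
      _ ≤ ((2 : ENNReal) ^ (m + 3)) ^ p * (2 * ((P m : ENNReal) * 2 ^ (m + 3))⁻¹) := by
          exact mul_le_mul' le_rfl (hLκ m)
      _ = _ := by ring

/-- A basis whose stages of type `m` have about `s m * (2 ^ (m + 3)) ^ (p₀ - 1)` directions. -/
theorem exists_basis {p₀ : ℝ} (hp₀ : 1 ≤ p₀) (s : ℕ → ℝ) (hs : ∀ m, 1 ≤ s m) :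
    ∃ B : TorusOmega → Set (Set TorusOmega), IsBusemannFellerBasis torusDist torusMeasure B ∧
      (∀ S ∈ ⋃ x, B x, IsTorusRectangle S) ∧
      (∀ p : ℝ, 1 ≤ p → (∃ A : ℝ, ∀ m, s m ≤ A * ((2 : ℝ) ^ (m + 3)) ^ (p - p₀)) →
        DifferentiatesLp torusDist torusMeasure B (ENNReal.ofReal p)) ∧
      (∀ p : ℝ, 1 ≤ p → (Summable fun m => ((2 : ℝ) ^ (m + 3)) ^ (p - p₀) / s m) →
        ¬ DifferentiatesLp torusDist torusMeasure B (ENNReal.ofReal p)) := by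
  have hs0 : ∀ m, 0 < s m := fun m => one_pos.trans_le (hs m)
  have hl1 : ∀ m : ℕ, (1 : ℝ) ≤ ((2 : ℝ) ^ (m + 3)) ^ (p₀ - 1) := fun m =>
    Real.one_le_rpow (one_le_pow₀ one_le_two) (by linarith)
  let P : ℕ → ℕ := fun m => ⌈s m * ((2 : ℝ) ^ (m + 3)) ^ (p₀ - 1)⌉₊
  have hPge : ∀ m, s m * ((2 : ℝ) ^ (m + 3)) ^ (p₀ - 1) ≤ P m := fun m => Nat.le_ceil _
  have hPge1 : ∀ m, 1 ≤ s m * ((2 : ℝ) ^ (m + 3)) ^ (p₀ - 1) := fun m =>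
    one_le_mul_of_one_le_of_one_le (hs m) (hl1 m)
  have hPle : ∀ m, (P m : ℝ) ≤ 2 * (s m * ((2 : ℝ) ^ (m + 3)) ^ (p₀ - 1)) := fun m => by
    have := Nat.ceil_lt_add_one (zero_le_one.trans (hPge1 m))
    linarith [hPge1 m]
  have hP : ∀ m, 0 < P m := fun m => Nat.ceil_pos.2 (one_pos.trans_le (hPge1 m))
  have hpow : ∀ m : ℕ, ((2 : ℝ) ^ (m + 3)) ^ (p₀ - 1) * 2 ^ (m + 3) = ((2 : ℝ) ^ (m + 3)) ^ p₀ := by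
    intro m
    rw [← Real.rpow_add_one (by positivity), sub_add_cancel]
  have htwo : ∀ m : ℕ, (2 : ENNReal) ^ m = ENNReal.ofReal (2 ^ m) := fun m => by
    rw [ENNReal.ofReal_pow (by norm_num)]
    norm_num
  obtain ⟨D, τ, hwidth, hdepth, htend, hcore, hreach, hsum⟩ := exists_stages P hP
  have hB := Stages.basis_isBusemannFeller (Stages.ae_frequently_mem_reach hreach)
  refine ⟨D.basis, hB, fun S hS => Stages.isTorusRectangle_of_mem_basis hS, ?_, ?_⟩
  · rintro p hp ⟨A, hA⟩
    refine Stages.differentiatesLp_basis hp (A := ENNReal.ofReal (2 * A)) (by finiteness)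
      (fun k => ?_) hcore.ne_top htend
    rw [hwidth, hdepth]
    generalize τ k = m
    have hA0 : 0 ≤ A := by
      by_contra! hlt
      have h1 := (hs m).trans (hA m)
      have h2 : 0 < ((2 : ℝ) ^ (m + 3)) ^ (p - p₀) := by positivity
      nlinarith
    rw [htwo, ENNReal.ofReal_rpow_of_pos (by positivity), ← ENNReal.ofReal_natCast,
      ← ENNReal.ofReal_mul (by positivity), ← ENNReal.ofReal_mul (by positivity)]
    refine ENNReal.ofReal_le_ofReal ?_
    calc (P m : ℝ) * 2 ^ (m + 3)
        ≤ 2 * (s m * ((2 : ℝ) ^ (m + 3)) ^ (p₀ - 1)) * 2 ^ (m + 3) := by gcongr; exact hPle m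
      _ = 2 * s m * ((2 : ℝ) ^ (m + 3)) ^ p₀ := by rw [← hpow]; ring
      _ ≤ 2 * (A * ((2 : ℝ) ^ (m + 3)) ^ (p - p₀)) * ((2 : ℝ) ^ (m + 3)) ^ p₀ := by
          gcongr; exact hA m
      _ = 2 * A * (((2 : ℝ) ^ (m + 3)) ^ (p - p₀) * ((2 : ℝ) ^ (m + 3)) ^ p₀) := by ring
      _ = _ := by rw [← Real.rpow_add (by positivity), sub_add_cancel]
  · intro p hp hsm
    refine Stages.not_differentiatesLp_basis hp (hsum p ?_) hcore hB
    refine ne_top_of_le_ne_top hsm.tsum_ofReal_ne_top (ENNReal.tsum_le_tsum fun m => ?_)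
    have hPm : (0 : ℝ) < P m := by exact_mod_cast hP m
    rw [htwo, ENNReal.ofReal_rpow_of_pos (by positivity), ← ENNReal.ofReal_natCast,
      ← ENNReal.ofReal_mul (by positivity), ← ENNReal.ofReal_inv_of_pos (by positivity),
      ← ENNReal.ofReal_mul (by positivity)]
    refine ENNReal.ofReal_le_ofReal ?_
    have hsm0 := hs0 m
    calc ((2 : ℝ) ^ (m + 3)) ^ p * ((P m : ℝ) * 2 ^ (m + 3))⁻¹
        ≤ ((2 : ℝ) ^ (m + 3)) ^ p *
            (s m * ((2 : ℝ) ^ (m + 3)) ^ (p₀ - 1) * 2 ^ (m + 3))⁻¹ := by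
          gcongr; exact hPge m
      _ = ((2 : ℝ) ^ (m + 3)) ^ p / ((2 : ℝ) ^ (m + 3)) ^ p₀ / s m := by
          rw [mul_assoc, hpow, mul_inv, div_eq_mul_inv, div_eq_mul_inv]; ring
      _ = _ := by rw [← Real.rpow_sub (by positivity)]

theorem DifferentiatesLp.mono_exponent {B : TorusOmega → Set (Set TorusOmega)} {p q : ENNReal}
    (h : DifferentiatesLp torusDist torusMeasure B p) (hpq : p ≤ q) :
    DifferentiatesLp torusDist torusMeasure B q :=
  fun f hf => h f (hf.mono_exponent hpq)

end TorusBeam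

open TorusBeam in
theorem theorem1p1 (p₀ : ℝ) (hp₀ : 1 ≤ p₀) :
    (∃ B : TorusOmega → Set (Set TorusOmega),
      IsBusemannFellerBasis torusDist torusMeasure B ∧
      (∀ S ∈ ⋃ x, B x, IsTorusRectangle S) ∧
      ∀ p : ENNReal, 1 ≤ p →
        (DifferentiatesLp torusDist torusMeasure B p ↔ ENNReal.ofReal p₀ ≤ p)) ∧
    (∃ B : TorusOmega → Set (Set TorusOmega),
      IsBusemannFellerBasis torusDist torusMeasure B ∧
      (∀ S ∈ ⋃ x, B x, IsTorusRectangle S) ∧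
      ∀ p : ENNReal, 1 ≤ p →
        (DifferentiatesLp torusDist torusMeasure B p ↔ ENNReal.ofReal p₀ < p)) := by
  constructor
  · obtain ⟨B, hB, hrect, hpos, hneg⟩ := exists_basis hp₀ (fun _ => 1) fun _ => le_rfl
    refine ⟨B, hB, hrect, fun p hp => ⟨fun h => ?_, fun h => ?_⟩⟩
    · by_contra! hlt
      lift p to NNReal using (hlt.trans_le le_top).ne
      have hp1 : (1 : ℝ) ≤ p := by exact_mod_cast hp
      have hlt' : (p : ℝ) < p₀ := by
        rwa [← ENNReal.ofReal_coe_nnreal, ENNReal.ofReal_lt_ofReal_iff (by linarith)] at hlt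
      refine hneg p hp1 ?_ (by rwa [ENNReal.ofReal_coe_nnreal])
      have h2 : (2 : ℝ) ^ ((p : ℝ) - p₀) < 1 :=
        Real.rpow_lt_one_of_one_lt_of_neg one_lt_two (by linarith)
      simp_rw [div_one, ← Real.rpow_pow_comm zero_le_two]
      exact (summable_nat_add_iff 3).2 (summable_geometric_of_lt_one (by positivity) h2)
    · exact DifferentiatesLp.mono_exponent (hpos p₀ hp₀ ⟨1, fun m => by simp⟩) h
  · obtain ⟨B, hB, hrect, hpos, hneg⟩ := exists_basis hp₀ (fun m => ((m + 3 : ℕ) : ℝ) ^ 2)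
      fun m => one_le_pow₀ (by exact_mod_cast Nat.le_add_left 1 (m + 2))
    refine ⟨B, hB, hrect, fun p hp => ⟨fun h => ?_, fun h => ?_⟩⟩
    · by_contra! hle
      refine hneg p₀ hp₀ ?_ (DifferentiatesLp.mono_exponent h hle)
      simp only [sub_self, Real.rpow_zero]
      exact (summable_nat_add_iff 3).2 (Real.summable_one_div_nat_pow.2 one_lt_two)
    · obtain ⟨q, -, hq, hqp⟩ := ENNReal.lt_iff_exists_real_btwn.1 h
      have hq' : p₀ < q := (ENNReal.ofReal_lt_ofReal_iff_of_nonneg (by linarith)).1 hq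
      refine DifferentiatesLp.mono_exponent (hpos q (by linarith) ?_) hqp.le
      have h2 : 1 < (2 : ℝ) ^ (q - p₀) := Real.one_lt_rpow one_lt_two (by linarith)
      obtain ⟨A, hA⟩ := (tendsto_pow_const_div_const_pow_of_one_lt 2 h2).bddAbove_range
      refine ⟨A, fun m => ?_⟩
      rw [← Real.rpow_pow_comm zero_le_two, ← div_le_iff₀ (by positivity)]
      exact hA ⟨m + 3, rfl⟩
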